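/- Notation. For a real matrix $A$, $\|A\|_F$ is the Frobenius norm. Let $d_1,d_2,r\ge 1$ and let $M^\star\in\mathbb{R}^{d_1\times d_2}$ have rank $r$, with singular values $\sigma_1^\star\ge\dots\ge\sigma_r^\star>0$ and condition number $\kappa^\star=\sigma_1^\star/\sigma_r^\star$. Assume that $M^\star$ is $\mu$-incoherent: for its rank-$r$ SVD $M^\star=XDY^\top$ ($X\in\mathbb{R}^{d_1\times r}$, $Y\in\mathbb{R}^{d_2\times r}$ with orthonormal columns), $\|e_i^\top X\|\le\sqrt{\mu r/d_1}$ for all $i\in[d_1]$ and $\|e_j^\top Y\|\le\sqrt{\mu r/d_2}$ for all $j\in[d_2]$. For $a\in\mathbb{R}$ let $\mathcal S_a$ be the set of $S\in\mathbb{R}^{d_1\times d_2}$ such that each row of $S$ has at most $a d_2$ non-zero entries, each column has at most $a d_1$ non-zero entries, and $|S_{ij}|\le 2\mu r\sigma_1^\star/\sqrt{d_1d_2}$ for all $i,j$. Let $S^\star\in\mathcal S_\alpha$ and $M_o=M^\star+S^\star$, and for $W=(U,V)\in\mathbb{R}^{d_1\times r}\times\mathbb{R}^{d_2\times r}$ (a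 Euclidean space with $\|W\|^2=\|U\|_F^2+\|V\|_F^2$) consider the robust PCA objective $$F(U,V)=\min_{S\in\mathcal S_{\gamma\alpha}}\tfrac12\|UV^\top+S-M_o\|_F^2+\tfrac18\|U^\top U-V^\top V\|_F^2 .$$ A function $f$ on a finite-dimensional Euclidean space is called $(\theta,\eta,\zeta)$-pseudo strict saddle if for every point $x$ at least one of the following holds: (1) $f$ is differentiable at $x$ and $\|\nabla f(x)\|\ge\theta$; (2) there is a smooth function $g$ with $g(y)\ge f(y)$ for all $y$, $g(x)=f(x)$ and $\lambda_{\min}(\nabla^2 g(x))\le-\eta$; (3) there is a local minimum $z$ of $f$ with $\|x-z\|\le\zeta$. Theorem. There are absolute constants $c,c_1,c_2,c_3>0$ and $k\in\mathbb{N}$ such that for all $d_1,d_2,r,M^\star,S^\star,\mu,\alpha,\gamma$ as above with $\gamma>c$ and $\gamma\alpha\cdot\mu r\cdot(\kappa^\star)^5\le\frac1c$: 1. every local minimum $(U,V)$ of $F$ satisfies $UV^\top=M^\star$; 2. for every $\epsilon$ with $0<\epsilon\le c_3\,(\sigma_r^\star)^{3/2}/(d_1+d_2)^k$ the objective $F$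 is $\left(\epsilon,\;c_1\sigma_r^\star,\;c_2\,\frac{\epsilon\sqrt{\kappa^\star}}{\sigma_r^\star}\right)$-pseudo strict saddle. -/

import Mathlib

namespace RobustPCA

noncomputable section

/-! ### Matrices, singular values, incoherence -/

/-- The squared Frobenius norm of a real matrix. -/
def frobeniusSq {m n : Type*} [Fintype m] [Fintype n] (A : Matrix m n ℝ) : ℝ :=
  ∑ i, ∑ j, A i j ^ 2

/-- The `k`-th largest singular value of a matrix, counted from `k = 0` and with multiplicity:
Mathlib's singular values of the linear map `x ↦ M x` between Euclidean spaces. -/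
def singularValue {d₁ d₂ : ℕ} (M : Matrix (Fin d₁) (Fin d₂) ℝ) (k : ℕ) : ℝ :=
  (Matrix.toEuclideanLin M).singularValues k

/-- The largest singular value `σ₁`. -/
def sigmaOne {d₁ d₂ : ℕ} (M : Matrix (Fin d₁) (Fin d₂) ℝ) : ℝ := singularValue M 0

/-- The `r`-th singular value `σ_r` (for `1 ≤ r`). -/
def sigmaR {d₁ d₂ : ℕ} (r : ℕ) (M : Matrix (Fin d₁) (Fin d₂) ℝ) : ℝ := singularValue M (r - 1)

/-- The condition number `κ = σ₁ / σ_r`. -/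
def condNumber {d₁ d₂ : ℕ} (r : ℕ) (M : Matrix (Fin d₁) (Fin d₂) ℝ) : ℝ :=
  sigmaOne M / sigmaR r M

/-- `M = X D Yᵀ` is a rank-`r` (reduced) singular value decomposition of `M`: the columns of `X`
and those of `Y` are orthonormal, and `D` is the diagonal matrix of the `r` largest singular
values of `M`. -/
structure IsReducedSVD {d₁ d₂ r : ℕ} (M : Matrix (Fin d₁) (Fin d₂) ℝ)
    (X : Matrix (Fin d₁) (Fin r) ℝ) (D : Matrix (Fin r) (Fin r) ℝ)
    (Y : Matrix (Fin d₂) (Fin r) ℝ) : Prop where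
  left_orthonormal : X.transpose * X = 1
  right_orthonormal : Y.transpose * Y = 1
  diag_eq : D = Matrix.diagonal (fun k : Fin r => singularValue M k)
  eq_mul : M = X * D * Y.transpose

/-- A rank-`r` matrix is `μ`-incoherent if, for its rank-`r` SVD `X D Yᵀ`, every row of `X` has
Euclidean norm at most `√(μ r / d₁)` and every row of `Y` has Euclidean norm at most
`√(μ r / d₂)`. (Two rank-`r` SVDs differ by an orthogonal `r × r` matrix acting on the
columns of `X` and of `Y`, so the row norms do not depend on the choice of the SVD.) -/
def IsIncoherent {d₁ d₂ : ℕ} (r : ℕ) (μ : ℝ) (M : Matrix (Fin d₁) (Fin d₂) ℝ) : Prop :=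
  M.rank = r ∧
    ∃ (X : Matrix (Fin d₁) (Fin r) ℝ) (D : Matrix (Fin r) (Fin r) ℝ)
      (Y : Matrix (Fin d₂) (Fin r) ℝ), IsReducedSVD M X D Y ∧
      (∀ i, ‖WithLp.toLp 2 (X i)‖ ≤ √(μ * r / d₁)) ∧
      (∀ j, ‖WithLp.toLp 2 (Y j)‖ ≤ √(μ * r / d₂))

/-! ### The sparse set -/

/-- Matrices with at most an `a`-fraction of non-zero entries in each row and in each column, all
of whose entries have absolute value at most `B`. -/
def sparseSet (d₁ d₂ : ℕ) (a B : ℝ) : Set (Matrix (Fin d₁) (Fin d₂) ℝ) :=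
  {S | (∀ i, ({j | S i j ≠ 0}.ncard : ℝ) ≤ a * d₂) ∧
       (∀ j, ({i | S i j ≠ 0}.ncard : ℝ) ≤ a * d₁) ∧
       ∀ i j, |S i j| ≤ B}

/-- The bound `2 μ r σ₁ / √(d₁ d₂)` on the entries of the sparse part. -/
def entryBound {d₁ d₂ : ℕ} (r : ℕ) (μ : ℝ) (M : Matrix (Fin d₁) (Fin d₂) ℝ) : ℝ :=
  2 * (μ * r * sigmaOne M / √((d₁ : ℝ) * d₂))

/-! ### The objective -/

/-- The space of pairs `W = (U, V)`, with `U` of size `d₁ × r` and `V` of size `d₂ × r`, as a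
Euclidean space: the norm is the Frobenius norm of the stacked matrix. -/
abbrev Pairs (d₁ d₂ r : ℕ) : Type := EuclideanSpace ℝ ((Fin d₁ ⊕ Fin d₂) × Fin r)

/-- The component `U` of `W = (U, V)`. -/
def matU {d₁ d₂ r : ℕ} (W : Pairs d₁ d₂ r) : Matrix (Fin d₁) (Fin r) ℝ :=
  Matrix.of fun i k => W (Sum.inl i, k)

/-- The component `V` of `W = (U, V)`. -/
def matV {d₁ d₂ r : ℕ} (W : Pairs d₁ d₂ r) : Matrix (Fin d₂) (Fin r) ℝ :=
  Matrix.of fun j k => W (Sum.inr j, k)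

/-- `½ ‖U Vᵀ + S - M_o‖_F²`. -/
def fitLoss {d₁ d₂ r : ℕ} (Mo : Matrix (Fin d₁) (Fin d₂) ℝ) (W : Pairs d₁ d₂ r)
    (S : Matrix (Fin d₁) (Fin d₂) ℝ) : ℝ :=
  1 / 2 * frobeniusSq (matU W * (matV W).transpose + S - Mo)

/-- `min_S ½ ‖U Vᵀ + S - M_o‖_F²` over `S` in the sparse set with density `a` and entry bound
`B`; the minimum is attained, see `minFitLoss_isLeast`. -/
def minFitLoss {d₁ d₂ r : ℕ} (a B : ℝ) (Mo : Matrix (Fin d₁) (Fin d₂) ℝ)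
    (W : Pairs d₁ d₂ r) : ℝ :=
  sInf (fitLoss Mo W '' sparseSet d₁ d₂ a B)

/-- The robust PCA objective
`min_S ½ ‖U Vᵀ + S - M_o‖_F² + ⅛ ‖Uᵀ U - Vᵀ V‖_F²`. -/
def objective {d₁ d₂ : ℕ} (r : ℕ) (a B : ℝ) (Mo : Matrix (Fin d₁) (Fin d₂) ℝ)
    (W : Pairs d₁ d₂ r) : ℝ :=
  minFitLoss a B Mo W +
    1 / 8 * frobeniusSq ((matU W).transpose * matU W - (matV W).transpose * matV W)

/-! ### The pseudo strict saddle property -/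

/-- The Hessian of `g` at `x`, as a linear operator: the derivative of the gradient field. -/
def hessian {E : Type*} [NormedAddCommGroup E] [InnerProductSpace ℝ E] [CompleteSpace E]
    (g : E → ℝ) (x : E) : E →L[ℝ] E :=
  fderiv ℝ (gradient g) x

/-- `f` is `(θ, η, ζ)`-pseudo strict saddle: at every `x`, either the gradient of `f` has norm at
least `θ`; or some smooth upper bound `g` of `f` that touches `f` at `x` has a Hessian at `x` whose
smallest eigenvalue is at most `-η`; or `x` is `ζ`-close to a local minimum of `f`.
In the first alternative the gradient has to exist. -/
def IsPseudoStrictSaddle {E : Type*} [NormedAddCommGroup E] [InnerProductSpace ℝ E]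
    [CompleteSpace E] (f : E → ℝ) (θ η ζ : ℝ) : Prop :=
  ∀ x : E,
    (DifferentiableAt ℝ f x ∧ θ ≤ ‖gradient f x‖) ∨
    (∃ g : E → ℝ, ContDiff ℝ ((⊤ : ℕ∞) : WithTop ℕ∞) g ∧ (∀ y, f y ≤ g y) ∧ g x = f x ∧
      ∃ l : ℝ, Module.End.HasEigenvalue (hessian g x : E →ₗ[ℝ] E) l ∧ l ≤ -η) ∨
    (∃ z : E, IsLocalMin f z ∧ ‖x - z‖ ≤ ζ)

/-! ### The minimum over the sparse set is attained -/

open Classical in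
theorem isCompact_sparseSet (d₁ d₂ : ℕ) (a B : ℝ) : IsCompact (sparseSet d₁ d₂ a B) := by
  let F : Set (Set (Fin d₁ × Fin d₂)) :=
    {T | (∀ i, ({j | (i, j) ∈ T}.ncard : ℝ) ≤ a * d₂) ∧
      (∀ j, ({i | (i, j) ∈ T}.ncard : ℝ) ≤ a * d₁)}
  let K : Set (Fin d₁ × Fin d₂) → Set (Matrix (Fin d₁) (Fin d₂) ℝ) := fun T =>
    Set.univ.pi (fun i => Set.univ.pi (fun j =>
      if (i, j) ∈ T then Set.Icc (-B) B else Set.Icc (-B) B ∩ {0}))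
  have hK : ∀ T, IsCompact (K T) := by
    intro T
    refine isCompact_univ_pi fun i => isCompact_univ_pi fun j => ?_
    split_ifs
    · exact isCompact_Icc
    · exact isCompact_Icc.inter_right isClosed_singleton
  have hrw : sparseSet d₁ d₂ a B = ⋃ T ∈ F, K T := by
    refine Set.ext fun S => ⟨?_, fun hS => ?_⟩
    · rintro ⟨h1, h2, h3⟩
      refine Set.mem_iUnion₂.2 ⟨{p | S p.1 p.2 ≠ 0}, ⟨h1, h2⟩, fun i _ j _ => ?_⟩
      by_cases h : S i j = 0
      · have h4 := h3 i j
        rw [h] at h4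
        simpa [h] using h4
      · simpa [h] using abs_le.1 (h3 i j)
    · obtain ⟨T, ⟨h1, h2⟩, h⟩ := Set.mem_iUnion₂.1 hS
      have hT : ∀ i j, S i j ≠ 0 → (i, j) ∈ T := by
        intro i j hne
        by_contra hn
        have h4 := h i trivial j trivial
        simp only [hn, if_false] at h4
        exact hne h4.2
      refine ⟨fun i => le_trans ?_ (h1 i), fun j => le_trans ?_ (h2 j), fun i j => ?_⟩
      · exact_mod_cast Set.ncard_le_ncard (fun j hj => hT i j hj) (Set.toFinite _)
      · exact_mod_cast Set.ncard_le_ncard (fun i hi => hT i j hi) (Set.toFinite _)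
      · have h4 := h i trivial j trivial
        refine abs_le.2 ?_
        by_cases hn : (i, j) ∈ T
        · simp only [hn, if_true] at h4
          exact h4
        · simp only [hn, if_false] at h4
          exact h4.1
  rw [hrw]
  exact (Set.toFinite F).isCompact_biUnion fun T _ => hK T

theorem minFitLoss_isLeast {d₁ d₂ r : ℕ} {a B : ℝ} (ha : 0 ≤ a) (hB : 0 ≤ B)
    (Mo : Matrix (Fin d₁) (Fin d₂) ℝ) (W : Pairs d₁ d₂ r) :
    IsLeast (fitLoss Mo W '' sparseSet d₁ d₂ a B) (minFitLoss a B Mo W) := by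
  have hne : (sparseSet d₁ d₂ a B).Nonempty :=
    ⟨0, fun i => by simpa using by positivity, fun j => by simpa using by positivity,
      fun i j => by simpa using hB⟩
  have hc : Continuous (fitLoss Mo W) := by
    unfold fitLoss frobeniusSq
    fun_prop
  exact ((isCompact_sparseSet d₁ d₂ a B).image hc).isLeast_sInf (hne.image _)

end

end RobustPCA

/-! The objective is a minimum, over the compact set of feasible sparse parts `S`, of the polynomials
`majorant Mo S`; each of them lies above the objective and the ones with an optimal `S` touch it.
So a local minimum of the objective is one of a touching majorant, and where the objective is
differentiable its gradient is that of a touching majorant. Where it is not differentiable, two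
touching majorants have different gradients (`differentiableAt_objective_or`, by Danskin's
compactness argument); the objective then has a concave kink, and smooth upper bounds with
arbitrarily negative curvature exist (`exists_upper_bound_of_kink`).

The rest is a statement about one majorant at a point `W = (U, V)`. Let `Z = (P, Q)` be the
balanced factorization of `M⋆` aligned with `W` by an orthogonal matrix (from a polar
decomposition), so that `Zᵀ W` is positive semidefinite, and let `Δ = W - Z = (a, b)`. On the ray
`Z + s Δ` the residuals of both squares in the majorant are `s L + s² B + E` and `s ℓ + s² β`, where
`L = P bᵀ + a Qᵀ`, `B = a bᵀ`, `E = S - S⋆`, and similarly `ℓ`, `β`. With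
`q = ‖L + B‖² + ¼ ‖ℓ + β‖²`, differentiating at `s = 1` gives

  `g'' - 4 g' = -3 q + (‖B‖² + ¼ ‖β‖²) - 4 ⟨L, E⟩ - 6 ⟨B, E⟩`.

* Alignment yields `‖B‖² + ¼ ‖β‖² ≤ 2 q` (`quadratic_le_residual`) and `σ_r ‖Δ‖² ≤ 3 q`
  (`distance_le_residual`). Both follow from trace identities for `r × r` Gram matrices.
* `⟨B, E⟩` is small because a sparse matrix with small entries has small operator norm
  (`abs_frobeniusInner_mul_transpose_le`); `⟨L, E⟩` is small because the rows of `P` and `Q` are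
  short by incoherence (`frobeniusInner_mul_transpose_sq_le`) and because optimality of `S` gives
  `‖E‖ ≤ 2 ‖U Vᵀ - M⋆‖`.

Hence `g'' ≤ 4 g' - (σ_r / 6) ‖Δ‖²` (`exists_direction_of_negative_curvature`). At a local minimum
this forces `Δ = 0`; when the gradient is smaller than `ε`, either `Δ` is a direction of curvature at
most `-σ_r / 12`, or `‖Δ‖ ≤ 48 ε / σ_r` and `Z` is a nearby global minimum. -/

namespace RobustPCA

section LinearAlgebra

open Matrix

/-! ### Polar decomposition and Gram matrices -/

variable {k m n : Type*} [Fintype k] [Fintype m] [Fintype n]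

/-- Polar decomposition: an orthogonal factor `R` of `A`, for which `Rᵀ A` is the positive
semidefinite square root of `Aᵀ A`. It is an isometric extension of the map `√(Aᵀ A) x ↦ A x`. -/
theorem exists_orthogonal_transpose_mul_posSemidef [DecidableEq k] (A : Matrix k k ℝ) :
    ∃ R : Matrix k k ℝ, Rᵀ * R = 1 ∧ (Rᵀ * A).PosSemidef := by
  open scoped MatrixOrder in
  obtain ⟨H, hH, hHA⟩ : ∃ H : Matrix k k ℝ, H.PosSemidef ∧ H * H = Aᵀ * A := by
    have h : (Aᵀ * A).PosSemidef := by
      simpa using posSemidef_conjTranspose_mul_self A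
    exact ⟨CFC.sqrt (Aᵀ * A), (CFC.sqrt_nonneg _).posSemidef, CFC.sqrt_mul_sqrt_self _ h.nonneg⟩
  have hHT : Hᵀ = H := by
    rw [← conjTranspose_eq_transpose_of_trivial]; exact hH.isHermitian
  let TA := toEuclideanLin A
  let TH := toEuclideanLin H
  have key : ∀ B : Matrix k k ℝ, ∀ x, ‖toEuclideanLin B x‖ ^ 2 =
      (x.ofLp) ⬝ᵥ ((Bᵀ * B) *ᵥ x.ofLp) := by
    intro B x
    rw [EuclideanSpace.real_norm_sq_eq, ← mulVec_mulVec, dotProduct_mulVec, vecMul_transpose]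
    simp [dotProduct, pow_two, Matrix.ofLp_toLpLin]
  have hnorm : ∀ x, ‖TA x‖ = ‖TH x‖ := by
    intro x
    have h : ‖TA x‖ ^ 2 = ‖TH x‖ ^ 2 := by rw [key, key, hHT, hHA]
    exact (sq_eq_sq₀ (norm_nonneg _) (norm_nonneg _)).1 h
  have hker : LinearMap.ker TH ≤ LinearMap.ker TA := fun x hx => by
    rw [LinearMap.mem_ker] at hx ⊢
    rw [← norm_eq_zero, hnorm, hx, norm_zero]
  let L₀ : LinearMap.range TH →ₗ[ℝ] EuclideanSpace ℝ k :=
    (LinearMap.ker TH).liftQ TA hker ∘ₗ TH.quotKerEquivRange.symm.toLinearMap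
  have hL₀ : ∀ x, L₀ ⟨TH x, LinearMap.mem_range_self TH x⟩ = TA x := by
    intro x
    simp only [L₀, LinearMap.comp_apply, LinearEquiv.coe_coe]
    rw [LinearMap.quotKerEquivRange_symm_apply_image]
    simp
  let L : LinearMap.range TH →ₗᵢ[ℝ] EuclideanSpace ℝ k :=
    { toLinearMap := L₀
      norm_map' := by
        rintro ⟨_, x, rfl⟩
        rw [hL₀, hnorm]
        rfl }
  let T := L.extend
  have hT : ∀ x, T (TH x) = TA x := fun x =>
    (L.extend_apply ⟨TH x, LinearMap.mem_range_self TH x⟩).trans (hL₀ x)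
  obtain ⟨R, hR⟩ : ∃ R : Matrix k k ℝ, toEuclideanLin R = T.toLinearMap :=
    ⟨toEuclideanLin.symm T.toLinearMap, by simp⟩
  have hRH : R * H = A := by
    apply toEuclideanLin.injective
    refine LinearMap.ext fun x => ?_
    have h1 : toEuclideanLin (R * H) = toEuclideanLin R ∘ₗ toEuclideanLin H :=
      toLpLin_mul_same _ _ _
    rw [h1, LinearMap.comp_apply, hR]
    exact hT x
  have hRR : Rᵀ * R = 1 := by
    have h1 : toEuclideanLin (Rᵀ * R) = toEuclideanLin (1 : Matrix k k ℝ) := by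
      have h2 : toEuclideanLin (Rᵀ * R) = toEuclideanLin Rᵀ ∘ₗ toEuclideanLin R :=
        toLpLin_mul_same _ _ _
      have h3 : toEuclideanLin Rᵀ = LinearMap.adjoint (toEuclideanLin R) := by
        rw [← Matrix.toEuclideanLin_conjTranspose_eq_adjoint, conjTranspose_eq_transpose_of_trivial]
      refine LinearMap.ext fun x => ext_inner_left ℝ fun y => ?_
      rw [h2, LinearMap.comp_apply, h3, LinearMap.adjoint_inner_right, hR]
      simp
    exact toEuclideanLin.injective h1
  refine ⟨R, hRR, ?_⟩
  rwa [← hRH, ← Matrix.mul_assoc, hRR, Matrix.one_mul]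

theorem frobeniusSq_eq_trace (A : Matrix m n ℝ) : frobeniusSq A = (Aᵀ * A).trace := by
  simp only [frobeniusSq, trace, diag_apply, mul_apply, transpose_apply, pow_two]
  exact Finset.sum_comm

theorem frobeniusSq_nonneg (A : Matrix m n ℝ) : 0 ≤ frobeniusSq A :=
  Finset.sum_nonneg fun _ _ => Finset.sum_nonneg fun _ _ => sq_nonneg _

/-- Frobenius inner products of products `x wᵀ` reduce to the Gram matrices of the factors. -/
theorem trace_transpose_mul_outer (x x' : Matrix m k ℝ) (w w' : Matrix n k ℝ) :
    ((x * wᵀ)ᵀ * (x' * w'ᵀ)).trace = (xᵀ * x' * (w'ᵀ * w)).trace := by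
  rw [transpose_mul, transpose_transpose, Matrix.mul_assoc, trace_mul_comm]
  simp only [Matrix.mul_assoc]

/-- The Gram matrices of the factors determine the norm of the linear-plus-quadratic increment of
a product `P Qᵀ`. -/
theorem frobeniusSq_increment (P a : Matrix m k ℝ) (Q b : Matrix n k ℝ) :
    frobeniusSq (P * bᵀ + a * Qᵀ + a * bᵀ) =
      (Pᵀ * P * (bᵀ * b)).trace + (Qᵀ * Q * (aᵀ * a)).trace + (aᵀ * a * (bᵀ * b)).trace +
        2 * (Pᵀ * a * (Qᵀ * b)).trace + 2 * (Pᵀ * a * (bᵀ * b)).trace +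
        2 * (aᵀ * a * (Qᵀ * b)).trace := by
  have c1 : (aᵀ * P * (bᵀ * Q)).trace = (Pᵀ * a * (Qᵀ * b)).trace := by
    rw [← trace_transpose]; simp only [transpose_mul, transpose_transpose]; rw [trace_mul_comm]
  have c2 : (aᵀ * P * (bᵀ * b)).trace = (Pᵀ * a * (bᵀ * b)).trace := by
    rw [← trace_transpose]; simp only [transpose_mul, transpose_transpose]; rw [trace_mul_comm]
  have c3 : (aᵀ * a * (bᵀ * Q)).trace = (aᵀ * a * (Qᵀ * b)).trace := by
    rw [← trace_transpose]; simp only [transpose_mul, transpose_transpose]; rw [trace_mul_comm]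
  have c4 := trace_mul_comm (aᵀ * a) (Qᵀ * Q)
  rw [frobeniusSq_eq_trace, transpose_add, transpose_add]
  simp only [Matrix.add_mul, Matrix.mul_add, trace_add, trace_transpose_mul_outer]
  linarith

/-- Trace identity behind the comparison of the lifted matrices `W Wᵀ` and `Z Zᵀ`, in terms of
`C = α + β` and `Y = y + z`. -/
theorem trace_gram_identity (α β y z : Matrix k k ℝ) (hα : αᵀ = α) (hβ : βᵀ = β) :
    4 * (α * β).trace + 8 * (y * z).trace + 8 * (y * β).trace + 8 * (α * z).trace +
        frobeniusSq (y + yᵀ - z - zᵀ + (α - β)) =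
      ((α + β) * (α + β)).trace + 4 * ((α + β) * (y + z)).trace +
        2 * ((y + z) * (y + z)).trace + 2 * frobeniusSq (y - z) := by
  have t1 : ∀ M N : Matrix k k ℝ, (Mᵀ * Nᵀ).trace = (M * N).trace := fun M N => by
    rw [← transpose_mul, trace_transpose, trace_mul_comm]
  have t2 : ∀ M N : Matrix k k ℝ, (M * Nᵀ).trace = (Mᵀ * N).trace := fun M N => by
    rw [← trace_transpose, transpose_mul, transpose_transpose, trace_mul_comm]
  have e1 := t1 y z
  have e2 := t2 α y
  have e3 := t2 α z
  have e4 := t2 β y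
  have e5 := t2 β z
  rw [hα] at e2 e3
  rw [hβ] at e4 e5
  simp only [frobeniusSq_eq_trace, transpose_add, transpose_sub, transpose_transpose, hα, hβ,
    add_mul, mul_add, sub_mul, mul_sub, trace_add, trace_sub, t1, e2, e3, e4, e5]
  simp only [t2]
  linarith [trace_mul_comm α β, trace_mul_comm y z, trace_mul_comm y α, trace_mul_comm y β,
    trace_mul_comm z α, trace_mul_comm z β, trace_mul_comm (yᵀ) z, trace_mul_comm (zᵀ) y,
    trace_mul_comm (yᵀ) α, trace_mul_comm (yᵀ) β, trace_mul_comm (zᵀ) α, trace_mul_comm (zᵀ) β,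
    e2, e3, e4, e5, t2 y y, t2 y z, t2 z y, t2 z z]

theorem trace_gram_mul_nonneg (a : Matrix m k ℝ) {H : Matrix k k ℝ} (hH : H.PosSemidef) :
    0 ≤ (aᵀ * a * H).trace := by
  rw [Matrix.mul_assoc, trace_mul_comm]
  simpa using (hH.mul_mul_conjTranspose_same a).trace_nonneg

/-- Four times the squared distance of the residuals, expressed in the Gram matrices
`C = aᵀa + bᵀb` and `Y = Pᵀa + Qᵀb`. -/
theorem four_mul_residual_eq (P a : Matrix m k ℝ) (Q b : Matrix n k ℝ) (hPQ : Pᵀ * P = Qᵀ * Q) :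
    4 * frobeniusSq (P * bᵀ + a * Qᵀ + a * bᵀ) +
        frobeniusSq (Pᵀ * a + (Pᵀ * a)ᵀ - Qᵀ * b - (Qᵀ * b)ᵀ + (aᵀ * a - bᵀ * b)) =
      ((aᵀ * a + bᵀ * b) * (aᵀ * a + bᵀ * b)).trace +
        4 * ((aᵀ * a + bᵀ * b) * (Pᵀ * a + Qᵀ * b)).trace +
        2 * ((Pᵀ * a + Qᵀ * b) * (Pᵀ * a + Qᵀ * b)).trace +
        2 * frobeniusSq (Pᵀ * a - Qᵀ * b) +
        4 * ((aᵀ * a + bᵀ * b) * (Pᵀ * P)).trace := by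
  have h := trace_gram_identity (aᵀ * a) (bᵀ * b) (Pᵀ * a) (Qᵀ * b) (by simp) (by simp)
  have h1 : ((aᵀ * a + bᵀ * b) * (Pᵀ * P)).trace =
      (Pᵀ * P * (bᵀ * b)).trace + (Qᵀ * Q * (aᵀ * a)).trace := by
    rw [Matrix.add_mul, trace_add, trace_mul_comm, ← hPQ, trace_mul_comm (bᵀ * b), add_comm]
  rw [frobeniusSq_increment]
  linarith

theorem four_mul_quadratic_eq (a : Matrix m k ℝ) (b : Matrix n k ℝ) :
    4 * frobeniusSq (a * bᵀ) + frobeniusSq (aᵀ * a - bᵀ * b) =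
      ((aᵀ * a + bᵀ * b) * (aᵀ * a + bᵀ * b)).trace := by
  simpa [frobeniusSq] using four_mul_residual_eq (0 : Matrix m k ℝ) a (0 : Matrix n k ℝ) b (by simp)

/-- Consequences of alignment, with `Y = Pᵀa + Qᵀb` and `C = aᵀa + bᵀb`: the matrix `Y` is symmetric,
and `tr (C (Y + 2 PᵀP)) ≥ 0` as the trace of a product of two positive semidefinite matrices. -/
theorem gram_of_aligned (P a : Matrix m k ℝ) (Q b : Matrix n k ℝ) (hPQ : Pᵀ * P = Qᵀ * Q)
    (hH : (Pᵀ * (P + a) + Qᵀ * (Q + b)).PosSemidef) :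
    (Pᵀ * a + Qᵀ * b)ᵀ = Pᵀ * a + Qᵀ * b ∧
    0 ≤ ((aᵀ * a + bᵀ * b) * (Pᵀ * a + Qᵀ * b)).trace +
      2 * ((aᵀ * a + bᵀ * b) * (Pᵀ * P)).trace := by
  have hsum : Pᵀ * (P + a) + Qᵀ * (Q + b) = Pᵀ * a + Qᵀ * b + (2 : ℝ) • (Pᵀ * P) := by
    rw [Matrix.mul_add, Matrix.mul_add, ← hPQ, two_smul]; abel
  rw [hsum] at hH
  have hT : (Pᵀ * a + Qᵀ * b + (2 : ℝ) • (Pᵀ * P))ᵀ = Pᵀ * a + Qᵀ * b + (2 : ℝ) • (Pᵀ * P) := by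
    rw [← conjTranspose_eq_transpose_of_trivial]; exact hH.isHermitian
  refine ⟨?_, ?_⟩
  · rw [transpose_add _ ((2 : ℝ) • (Pᵀ * P)), transpose_smul, transpose_mul Pᵀ P,
      transpose_transpose] at hT
    exact add_right_cancel hT
  · have h := add_nonneg (trace_gram_mul_nonneg a hH) (trace_gram_mul_nonneg b hH)
    rw [← trace_add, ← Matrix.add_mul, Matrix.mul_add _ _ ((2 : ℝ) • (Pᵀ * P)), Matrix.mul_smul,
      trace_add, trace_smul, smul_eq_mul] at h
    exact h

/-- After alignment, the quadratic part of the increment is controlled by the residual. -/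
theorem quadratic_le_residual (P a : Matrix m k ℝ) (Q b : Matrix n k ℝ) (hPQ : Pᵀ * P = Qᵀ * Q)
    (hH : (Pᵀ * (P + a) + Qᵀ * (Q + b)).PosSemidef) :
    4 * frobeniusSq (a * bᵀ) + frobeniusSq (aᵀ * a - bᵀ * b) ≤
      2 * (4 * frobeniusSq (P * bᵀ + a * Qᵀ + a * bᵀ) +
        frobeniusSq (Pᵀ * a + (Pᵀ * a)ᵀ - Qᵀ * b - (Qᵀ * b)ᵀ + (aᵀ * a - bᵀ * b))) := by
  obtain ⟨hY, hC⟩ := gram_of_aligned P a Q b hPQ hH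
  rw [four_mul_residual_eq P a Q b hPQ, four_mul_quadratic_eq]
  have hd := frobeniusSq_nonneg (Pᵀ * a - Qᵀ * b)
  have hCT : (aᵀ * a + bᵀ * b)ᵀ = aᵀ * a + bᵀ * b := by simp
  generalize Pᵀ * a + Qᵀ * b = Y at *
  generalize aᵀ * a + bᵀ * b = C at *
  have hs := frobeniusSq_nonneg (C + (2 : ℝ) • Y)
  rw [frobeniusSq_eq_trace, transpose_add, transpose_smul, hCT, hY] at hs
  simp only [Matrix.add_mul, Matrix.mul_add, Matrix.mul_smul, Matrix.smul_mul, trace_add,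
    trace_smul, smul_eq_mul, trace_mul_comm Y C] at hs
  linarith

/-- After alignment, the residual controls the distance to the global minimum. -/
theorem distance_le_residual (P a : Matrix m k ℝ) (Q b : Matrix n k ℝ) (hPQ : Pᵀ * P = Qᵀ * Q)
    (hH : (Pᵀ * (P + a) + Qᵀ * (Q + b)).PosSemidef) :
    4 * ((aᵀ * a + bᵀ * b) * (Pᵀ * P)).trace ≤
      3 * (4 * frobeniusSq (P * bᵀ + a * Qᵀ + a * bᵀ) +
        frobeniusSq (Pᵀ * a + (Pᵀ * a)ᵀ - Qᵀ * b - (Qᵀ * b)ᵀ + (aᵀ * a - bᵀ * b))) := by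
  obtain ⟨hY, hC⟩ := gram_of_aligned P a Q b hPQ hH
  rw [four_mul_residual_eq P a Q b hPQ]
  have hd := frobeniusSq_nonneg (Pᵀ * a - Qᵀ * b)
  have hCT : (aᵀ * a + bᵀ * b)ᵀ = aᵀ * a + bᵀ * b := by simp
  generalize Pᵀ * a + Qᵀ * b = Y at *
  generalize aᵀ * a + bᵀ * b = C at *
  -- The weight `4 / 3` leaves nonnegative multiples of `tr (Y Y)`, `tr (C (Y + 2 PᵀP))` and
  -- `tr (C PᵀP)`.
  have hs := frobeniusSq_nonneg (C + (4 / 3 : ℝ) • Y)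
  have hs' := frobeniusSq_nonneg Y
  rw [frobeniusSq_eq_trace, hY] at hs'
  rw [frobeniusSq_eq_trace, transpose_add, transpose_smul, hCT, hY] at hs
  simp only [Matrix.add_mul, Matrix.mul_add, Matrix.mul_smul, Matrix.smul_mul, trace_add,
    trace_smul, smul_eq_mul, trace_mul_comm Y C] at hs
  linarith

end LinearAlgebra

open Filter Topology

/-! ### Curvature of smooth upper bounds, and minima of compact families -/

theorem differentiableAt_fderiv_of_contDiff {E : Type*} [NormedAddCommGroup E] [NormedSpace ℝ E]
    {g : E → ℝ} (hg : ContDiff ℝ ((⊤ : ℕ∞) : WithTop ℕ∞) g) (x : E) :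
    DifferentiableAt ℝ (fderiv ℝ g) x := by
  have h2 : ContDiff ℝ 2 g := contDiff_infty.1 hg 2
  exact (h2.fderiv_right (m := 1) (by norm_num)).differentiable one_ne_zero x

theorem hasDerivAt_quartic (a₀ a₁ a₂ a₃ a₄ t : ℝ) :
    HasDerivAt (fun t : ℝ => a₀ + a₁ * t + a₂ * t ^ 2 + a₃ * t ^ 3 + a₄ * t ^ 4)
      (a₁ + 2 * a₂ * t + 3 * a₃ * t ^ 2 + 4 * a₄ * t ^ 3) t := by
  refine HasDerivAt.congr_deriv ((((((hasDerivAt_id' t).const_mul a₁).const_add a₀).fun_add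
    ((hasDerivAt_pow 2 t).const_mul a₂)).fun_add ((hasDerivAt_pow 3 t).const_mul a₃)).fun_add
    ((hasDerivAt_pow 4 t).const_mul a₄)) ?_
  norm_num
  ring

section Calculus

variable {E : Type*} [NormedAddCommGroup E] [InnerProductSpace ℝ E]

theorem norm_gradient [CompleteSpace E] (f : E → ℝ) (x : E) : ‖gradient f x‖ = ‖fderiv ℝ f x‖ := by
  simp [gradient]

theorem inner_hessian [CompleteSpace E] {g : E → ℝ} (hg : ContDiff ℝ ((⊤ : ℕ∞) : WithTop ℕ∞) g) (x v w : E) :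
    inner ℝ (hessian g x v) w = fderiv ℝ (fderiv ℝ g) x v w := by
  have hd := differentiableAt_fderiv_of_contDiff hg x
  have h := ((InnerProductSpace.toDual ℝ E).symm.toContinuousLinearEquiv.toContinuousLinearMap.hasFDerivAt
    (x := fderiv ℝ g x)).comp x hd.hasFDerivAt
  have h' : hessian g x = ((InnerProductSpace.toDual ℝ E).symm.toContinuousLinearEquiv.toContinuousLinearMap).comp
      (fderiv ℝ (fderiv ℝ g) x) := h.fderiv
  rw [h']
  simp

theorem hessian_isSymmetric [CompleteSpace E] {g : E → ℝ} (hg : ContDiff ℝ ((⊤ : ℕ∞) : WithTop ℕ∞) g) (x : E) :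
    (hessian g x : E →ₗ[ℝ] E).IsSymmetric := by
  intro v w
  have hs : IsSymmSndFDerivAt ℝ g x :=
    have h2 : ContDiff ℝ 2 g := contDiff_infty.1 hg 2
    h2.contDiffAt.isSymmSndFDerivAt (by simp)
  rw [real_inner_comm]
  simp only [ContinuousLinearMap.coe_coe]
  rw [real_inner_comm, inner_hessian hg, real_inner_comm, inner_hessian hg]
  exact hs v w

/-- A direction of negative curvature produces an eigenvalue of the Hessian at least as
negative. -/
theorem exists_hasEigenvalue_hessian_le [CompleteSpace E] [FiniteDimensional ℝ E] {g : E → ℝ}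
    (hg : ContDiff ℝ ((⊤ : ℕ∞) : WithTop ℕ∞) g) {x v : E} (hv : v ≠ 0) {η : ℝ}
    (h : fderiv ℝ (fderiv ℝ g) x v v ≤ -η * ‖v‖ ^ 2) :
    ∃ l : ℝ, Module.End.HasEigenvalue (hessian g x : E →ₗ[ℝ] E) l ∧ l ≤ -η := by
  have : Nontrivial E := ⟨⟨v, 0, hv⟩⟩
  refine ⟨_, (hessian_isSymmetric hg x).hasEigenvalue_iInf_of_finiteDimensional, ?_⟩
  have hbdd : BddBelow (Set.range fun y : {y : E // y ≠ 0} =>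
      RCLike.re (inner ℝ ((hessian g x : E →ₗ[ℝ] E) y) (y : E)) / ‖(y : E)‖ ^ 2) := by
    refine ⟨-‖hessian g x‖, ?_⟩
    rintro _ ⟨⟨y, hy⟩, rfl⟩
    have hy' : 0 < ‖y‖ ^ 2 := by positivity
    simp only [RCLike.re_to_real, ContinuousLinearMap.coe_coe]
    rw [le_div_iff₀ hy']
    have h1 := abs_real_inner_le_norm (hessian g x y) y
    have h2 := (hessian g x).le_opNorm y
    have h3 := neg_abs_le (inner ℝ (hessian g x y) y)
    nlinarith [norm_nonneg y]
  refine (ciInf_le hbdd ⟨v, hv⟩).trans ?_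
  have hv' : 0 < ‖v‖ ^ 2 := by positivity
  simp only [RCLike.re_to_real, ContinuousLinearMap.coe_coe]
  rw [div_le_iff₀ hv', inner_hessian hg]
  exact h

theorem hasDerivAt_line {g : E → ℝ} (hg : ContDiff ℝ ((⊤ : ℕ∞) : WithTop ℕ∞) g) (x v : E)
    (t : ℝ) : HasDerivAt (fun t : ℝ => g (x + t • v)) (fderiv ℝ g (x + t • v) v) t := by
  have hl : HasDerivAt (fun t : ℝ => x + t • v) v t := by
    simpa using ((hasDerivAt_id t).smul_const v).const_add x
  have hd : DifferentiableAt ℝ g (x + t • v) := hg.differentiable (by simp) _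
  exact hd.hasFDerivAt.comp_hasDerivAt t hl

theorem hasDerivAt_fderiv_line {g : E → ℝ} (hg : ContDiff ℝ ((⊤ : ℕ∞) : WithTop ℕ∞) g) (x v : E) :
    HasDerivAt (fun t : ℝ => fderiv ℝ g (x + t • v) v) (fderiv ℝ (fderiv ℝ g) x v v) 0 := by
  have hl : HasDerivAt (fun t : ℝ => x + t • v) v 0 := by
    simpa using ((hasDerivAt_id (0 : ℝ)).smul_const v).const_add x
  have hd := differentiableAt_fderiv_of_contDiff hg (x + (0 : ℝ) • v)
  have e1 : HasDerivAt (fun t : ℝ => fderiv ℝ g (x + t • v))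
      (fderiv ℝ (fderiv ℝ g) (x + (0 : ℝ) • v) v) 0 := hd.hasFDerivAt.comp_hasDerivAt 0 hl
  rw [zero_smul, add_zero] at e1
  exact (ContinuousLinearMap.apply ℝ ℝ v).hasFDerivAt.comp_hasDerivAt 0 e1

/-- The first two derivatives of a smooth function along a line can be read off from its
restriction to the line. -/
theorem fderiv_of_line {g : E → ℝ} (hg : ContDiff ℝ ((⊤ : ℕ∞) : WithTop ℕ∞) g)
    {x v : E} {p : ℝ → ℝ} {c : ℝ} (h : ∀ t : ℝ, HasDerivAt (fun t : ℝ => g (x + t • v)) (p t) t)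
    (hp : HasDerivAt p c 0) :
    fderiv ℝ g x v = p 0 ∧ fderiv ℝ (fderiv ℝ g) x v v = c := by
  have h1 : (fun t : ℝ => fderiv ℝ g (x + t • v) v) = p :=
    funext fun t => (hasDerivAt_line hg x v t).unique (h t)
  refine ⟨by simpa using congrFun h1 0, ?_⟩
  have h2 := hasDerivAt_fderiv_line hg x v
  rw [h1] at h2
  exact h2.unique hp

/-- The first two derivatives of a smooth function whose restriction to a line is a quartic
polynomial. -/
theorem fderiv_of_quartic_on_line {g : E → ℝ} (hg : ContDiff ℝ ((⊤ : ℕ∞) : WithTop ℕ∞) g)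
    {x v : E} {a₀ a₁ a₂ a₃ a₄ : ℝ}
    (h : ∀ t : ℝ, g (x + t • v) = a₀ + a₁ * t + a₂ * t ^ 2 + a₃ * t ^ 3 + a₄ * t ^ 4) :
    fderiv ℝ g x v = a₁ ∧ fderiv ℝ (fderiv ℝ g) x v v = 2 * a₂ := by
  have h' := fderiv_of_line hg (x := x) (v := v)
    (p := fun t => a₁ + 2 * a₂ * t + 3 * a₃ * t ^ 2 + 4 * a₄ * t ^ 3) (c := 2 * a₂)
    (fun t => by rw [funext h]; exact hasDerivAt_quartic a₀ a₁ a₂ a₃ a₄ t)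
    (by simpa using hasDerivAt_quartic a₁ (2 * a₂) (3 * a₃) (4 * a₄) 0 0)
  simpa using h'

/-- A differentiable function and a differentiable upper bound touching it have the same
derivative at the point of contact. -/
theorem fderiv_eq_of_touching {f g : E → ℝ} {x : E} (hf : DifferentiableAt ℝ f x)
    (hg : DifferentiableAt ℝ g x) (hle : ∀ y, f y ≤ g y) (hx : g x = f x) :
    fderiv ℝ f x = fderiv ℝ g x := by
  have hmin : IsLocalMin (fun y => g y - f y) x :=
    Eventually.of_forall fun y => by simpa [hx] using hle y
  have h := hmin.fderiv_eq_zero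
  rw [fderiv_fun_sub hg hf] at h
  exact (sub_eq_zero.1 h).symm

/-- A function below two smooth functions that touch it at `x` with different derivatives has a
concave kink at `x`, so it has smooth upper bounds touching at `x` whose Hessian is as negative as
one likes. -/
theorem exists_upper_bound_of_kink [CompleteSpace E] [FiniteDimensional ℝ E] {f G₁ G₂ : E → ℝ}
    {x : E} (hG₁ : ContDiff ℝ ((⊤ : ℕ∞) : WithTop ℕ∞) G₁)
    (hG₂ : ContDiff ℝ ((⊤ : ℕ∞) : WithTop ℕ∞) G₂) (h₁ : ∀ y, f y ≤ G₁ y) (h₂ : ∀ y, f y ≤ G₂ y)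
    (hx₁ : G₁ x = f x) (hx₂ : G₂ x = f x) (hne : fderiv ℝ G₁ x ≠ fderiv ℝ G₂ x) (η : ℝ) :
    ∃ g : E → ℝ, ContDiff ℝ ((⊤ : ℕ∞) : WithTop ℕ∞) g ∧ (∀ y, f y ≤ g y) ∧ g x = f x ∧
      ∃ l : ℝ, Module.End.HasEigenvalue (hessian g x : E →ₗ[ℝ] E) l ∧ l ≤ -η := by
  obtain ⟨v, hv⟩ : ∃ v, fderiv ℝ G₁ x v - fderiv ℝ G₂ x v ≠ 0 := by
    by_contra! h
    exact hne (ContinuousLinearMap.ext fun v => sub_eq_zero.1 (h v))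
  have hv0 : v ≠ 0 := fun h => hv (by simp [h])
  set φ := fderiv ℝ G₁ x v - fderiv ℝ G₂ x v with hφ
  set b := (fderiv ℝ (fderiv ℝ G₁) x v v + fderiv ℝ (fderiv ℝ G₂) x v v) / 2 with hb
  -- `K` is large enough for the second derivative along `v` to be at most `-η ‖v‖²`.
  obtain ⟨K, hK, hKv⟩ : ∃ K : ℝ, 0 ≤ K ∧ b + η * ‖v‖ ^ 2 ≤ 2 * K * φ ^ 2 := by
    refine ⟨|b + η * ‖v‖ ^ 2| / (2 * φ ^ 2), by positivity, ?_⟩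
    have : 2 * (|b + η * ‖v‖ ^ 2| / (2 * φ ^ 2)) * φ ^ 2 = |b + η * ‖v‖ ^ 2| := by
      field_simp
    rw [this]
    exact le_abs_self _
  let ψ : E → ℝ := fun y => G₁ y - G₂ y
  -- The bound comes from `min G₁ G₂ = (G₁ + G₂) / 2 - |ψ| / 2` and
  -- `|ψ| / 2 ≥ K ψ² - 4 K³ ψ⁴`.
  let g : E → ℝ := fun y => (1 / 2 : ℝ) * (G₁ y + G₂ y) - K * ψ y ^ 2 + 4 * K ^ 3 * ψ y ^ 4
  have hg : ContDiff ℝ ((⊤ : ℕ∞) : WithTop ℕ∞) g := by fun_prop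
  refine ⟨g, hg, fun y => ?_, by simp only [g, ψ, hx₁, hx₂]; ring,
    exists_hasEigenvalue_hessian_le hg hv0 ?_⟩
  · have h1 := h₁ y
    have h2 := h₂ y
    have h3 : ψ y = G₁ y - G₂ y := rfl
    simp only [g]
    generalize ψ y = s at *
    have h4 : f y ≤ (1 / 2 : ℝ) * (G₁ y + G₂ y) - |s| / 2 := by
      rcases abs_cases s with ⟨h, _⟩ | ⟨h, _⟩ <;> rw [h] <;> linarith
    -- Elementary: `u ≤ 1 + u³` for `u = 2 K |s|`, multiplied by `|s| / 2`.
    have h5 : K * s ^ 2 ≤ |s| / 2 + 4 * K ^ 3 * s ^ 4 := by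
      have hu : 0 ≤ 2 * K * |s| := by positivity
      have h6 : 2 * K * |s| ≤ 1 + (2 * K * |s|) ^ 3 := by
        generalize 2 * K * |s| = u at *
        nlinarith [sq_nonneg (u - 1), mul_nonneg hu (sq_nonneg (u - 1))]
      have h7 : s ^ 2 = |s| ^ 2 := (sq_abs s).symm
      have h8 : s ^ 4 = |s| ^ 4 := by rw [show s ^ 4 = (s ^ 2) ^ 2 by ring, h7]; ring
      rw [h7, h8]
      nlinarith [mul_le_mul_of_nonneg_left h6 (abs_nonneg s)]
    linarith
  · have l₁ := hasDerivAt_line hG₁ x v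
    have l₂ := hasDerivAt_line hG₂ x v
    have m₁ := hasDerivAt_fderiv_line hG₁ x v
    have m₂ := hasDerivAt_fderiv_line hG₂ x v
    have hline := fun t => ((((l₁ t).fun_add (l₂ t)).const_mul (1 / 2 : ℝ)).fun_sub
      ((((l₁ t).fun_sub (l₂ t)).fun_pow 2).const_mul K)).fun_add
      ((((l₁ t).fun_sub (l₂ t)).fun_pow 4).const_mul (4 * K ^ 3))
    have hline' := (((m₁.fun_add m₂).const_mul (1 / 2 : ℝ)).fun_sub
      (((((l₁ 0).fun_sub (l₂ 0)).const_mul 2).fun_mul (m₁.fun_sub m₂)).const_mul K)).fun_add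
      ((((((l₁ 0).fun_sub (l₂ 0)).fun_pow 3).const_mul 4).fun_mul
        (m₁.fun_sub m₂)).const_mul (4 * K ^ 3))
    rw [(fderiv_of_line hg (fun t => (hline t).congr_deriv (by norm_num)) hline').2]
    simp only [zero_smul, add_zero, hx₁, hx₂, sub_self, ← hφ]
    norm_num
    nlinarith

/-- Danskin's theorem in contrapositive form: a minimum of a compact family of functions is
differentiable at `x` unless two of the functions that attain the minimum at `x` have different
derivatives. -/
theorem differentiableAt_or_exists_ne {𝒮 : Type*} [TopologicalSpace 𝒮] {K : Set 𝒮}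
    (hK : IsCompact K) {f : E → ℝ} {G : 𝒮 → E → ℝ} {x : E} {D : 𝒮 → E →L[ℝ] ℝ} {ρ : E → ℝ}
    (hGc : Continuous fun s => G s x) (hDc : Continuous D)
    (hG : ∀ s ∈ K, ∀ h, |G s (x + h) - G s x - D s h| ≤ ρ h)
    (hρ : ρ =o[𝓝 0] fun h : E => h)
    (hle : ∀ s ∈ K, ∀ y, f y ≤ G s y) (hatt : ∀ y, ∃ s ∈ K, G s y = f y) :
    DifferentiableAt ℝ f x ∨
      ∃ s₁ ∈ K, ∃ s₂ ∈ K, G s₁ x = f x ∧ G s₂ x = f x ∧ D s₁ ≠ D s₂ := by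
  by_contra! hcon
  obtain ⟨hnd, hact⟩ := hcon
  obtain ⟨s₀, hs₀, hs₀x⟩ := hatt x
  obtain ⟨B, hB⟩ := hK.exists_bound_of_continuousOn hDc.continuousOn
  refine hnd (HasFDerivAt.differentiableAt (f' := D s₀) ?_)
  rw [hasFDerivAt_iff_isLittleO_nhds_zero, Asymptotics.isLittleO_iff]
  intro ε hε
  -- Members of the family whose derivative is far from `D s₀` stay away from the minimum at `x`.
  obtain ⟨m, hm, hmK⟩ : ∃ m > 0, ∀ s ∈ K, ε / 2 ≤ ‖D s - D s₀‖ → f x + m ≤ G s x := by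
    have hK' : IsCompact (K ∩ {s | ε / 2 ≤ ‖D s - D s₀‖}) :=
      hK.inter_right (isClosed_le continuous_const (by fun_prop))
    rcases (K ∩ {s | ε / 2 ≤ ‖D s - D s₀‖}).eq_empty_or_nonempty with he | hne
    · refine ⟨1, one_pos, fun s hs h => ?_⟩
      have : s ∈ K ∩ {s | ε / 2 ≤ ‖D s - D s₀‖} := ⟨hs, h⟩
      rw [he] at this
      exact this.elim
    · obtain ⟨s₁, ⟨hs₁, hs₁'⟩, hmin⟩ := hK'.exists_isMinOn hne hGc.continuousOn
      refine ⟨G s₁ x - f x, ?_, fun s hs h => ?_⟩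
      · refine sub_pos.2 (lt_of_le_of_ne (hle s₁ hs₁ x) fun h => ?_)
        have := hact s₁ hs₁ s₀ hs₀ h.symm hs₀x
        simp only [Set.mem_ofPred_eq, this, sub_self, norm_zero] at hs₁'
        linarith
      · have : G s₁ x ≤ G s x := hmin ⟨hs, h⟩
        linarith
  have hB0 : 0 ≤ B := (norm_nonneg _).trans (hB s₀ hs₀)
  have ev1 : ∀ᶠ h : E in 𝓝 0, 2 * (B * ‖h‖ + ε / 2 * ‖h‖) < m := by
    have : Tendsto (fun h : E => 2 * (B * ‖h‖ + ε / 2 * ‖h‖)) (𝓝 0) (𝓝 0) := by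
      have hc : Continuous fun h : E => 2 * (B * ‖h‖ + ε / 2 * ‖h‖) := by fun_prop
      simpa using hc.tendsto 0
    exact this.eventually (gt_mem_nhds hm)
  filter_upwards [ev1, Asymptotics.isLittleO_iff.1 hρ (half_pos hε)] with h h1 h2
  have h2' : ρ h ≤ ε / 2 * ‖h‖ := (le_abs_self _).trans h2
  have hup := hle s₀ hs₀ (x + h)
  have hup' := abs_le.1 (hG s₀ hs₀ h)
  obtain ⟨s, hs, hsx⟩ := hatt (x + h)
  have hlo := abs_le.1 (hG s hs h)
  have hsf := hle s hs x
  have hDs : |D s h| ≤ B * ‖h‖ := ((D s).le_opNorm h).trans (by gcongr; exact hB s hs)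
  have hD₀ : |D s₀ h| ≤ B * ‖h‖ := ((D s₀).le_opNorm h).trans (by gcongr; exact hB s₀ hs₀)
  have hclose : ‖D s - D s₀‖ ≤ ε / 2 := by
    by_contra! hfar
    have := hmK s hs hfar.le
    linarith [abs_le.1 hDs, abs_le.1 hD₀]
  have hdiff : |D s h - D s₀ h| ≤ ε / 2 * ‖h‖ :=
    ((D s - D s₀).le_opNorm h).trans (by gcongr)
  rw [Real.norm_eq_abs, abs_le]
  have := abs_le.1 hdiff
  have hn := mul_nonneg hε.le (norm_nonneg h)
  constructor <;> linarith

end Calculus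

open Matrix

/-! ### The Frobenius inner product -/

section Frobenius

variable {k m n : Type*} [Fintype k] [Fintype m] [Fintype n]

/-- The Frobenius inner product of two real matrices. -/
def frobeniusInner (A B : Matrix m n ℝ) : ℝ := ∑ i, ∑ j, A i j * B i j

theorem frobeniusInner_add_left (A B C : Matrix m n ℝ) :
    frobeniusInner (A + B) C = frobeniusInner A C + frobeniusInner B C := by
  simp [frobeniusInner, add_mul, Finset.sum_add_distrib]

theorem frobeniusInner_comm (A B : Matrix m n ℝ) : frobeniusInner A B = frobeniusInner B A := by
  simp [frobeniusInner, mul_comm]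

theorem frobeniusInner_transpose (A B : Matrix m n ℝ) :
    frobeniusInner Aᵀ Bᵀ = frobeniusInner A B := by
  simp only [frobeniusInner, transpose_apply]
  exact Finset.sum_comm

theorem frobeniusSq_transpose (A : Matrix m n ℝ) : frobeniusSq Aᵀ = frobeniusSq A := by
  simp only [frobeniusSq, transpose_apply]
  exact Finset.sum_comm

theorem frobeniusInner_smul_left (t : ℝ) (A B : Matrix m n ℝ) :
    frobeniusInner (t • A) B = t * frobeniusInner A B := by
  simp [frobeniusInner, Finset.mul_sum, mul_assoc]

theorem frobeniusSq_add (A B : Matrix m n ℝ) :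
    frobeniusSq (A + B) = frobeniusSq A + 2 * frobeniusInner A B + frobeniusSq B := by
  simp only [frobeniusSq, frobeniusInner, Finset.mul_sum, ← Finset.sum_add_distrib, Matrix.add_apply]
  exact Finset.sum_congr rfl fun i _ => Finset.sum_congr rfl fun j _ => by ring

theorem frobeniusSq_smul (t : ℝ) (A : Matrix m n ℝ) :
    frobeniusSq (t • A) = t ^ 2 * frobeniusSq A := by
  simp [frobeniusSq, Finset.mul_sum, mul_pow]

theorem frobeniusSq_smul_add_smul_add (s t : ℝ) (A B C : Matrix m n ℝ) :
    frobeniusSq (s • A + t • B + C) = s ^ 2 * frobeniusSq A + t ^ 2 * frobeniusSq B +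
      frobeniusSq C + 2 * (s * t) * frobeniusInner A B + 2 * s * frobeniusInner A C +
      2 * t * frobeniusInner B C := by
  rw [frobeniusSq_add, frobeniusSq_add, frobeniusInner_add_left, frobeniusInner_smul_left,
    frobeniusInner_smul_left, frobeniusInner_smul_left, frobeniusInner_comm A (t • B),
    frobeniusInner_smul_left, frobeniusInner_comm B A, frobeniusSq_smul, frobeniusSq_smul]
  ring

/-- A correction `B` that does not increase the norm of `A` has norm at most `2 ‖A‖`. -/
theorem frobeniusSq_le_of_add_le {A B : Matrix m n ℝ}
    (h : frobeniusSq (A + B) ≤ frobeniusSq A) : frobeniusSq B ≤ 4 * frobeniusSq A := by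
  have h1 := frobeniusSq_nonneg (A + (A + B))
  have h2 : frobeniusSq B = frobeniusSq ((-1 : ℝ) • A + (1 : ℝ) • (A + B) + 0) := by
    congr 1; simp
  have h3 : frobeniusSq (A + (A + B)) = frobeniusSq ((1 : ℝ) • A + (1 : ℝ) • (A + B) + 0) := by
    congr 1; simp
  have h4 : ∀ X : Matrix m n ℝ, frobeniusInner X 0 = 0 := by simp [frobeniusInner]
  have h5 : frobeniusSq (0 : Matrix m n ℝ) = 0 := by simp [frobeniusSq]
  rw [frobeniusSq_smul_add_smul_add, h4, h4, h5] at h2 h3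
  linarith

end Frobenius

/-! ### Pairings with sparse matrices -/

section Sparse

open Classical in
theorem sum_support_eq_ncard {d : ℕ} (f : Fin d → ℝ) :
    ∑ j, (if f j ≠ 0 then (1 : ℝ) else 0) = ({j | f j ≠ 0}.ncard : ℝ) := by
  rw [Finset.sum_boole, Set.ncard_eq_toFinset_card']
  simp

/-- A sparse matrix with small entries has small operator norm: Schur's test with the weights
`√d₁` and `√d₂`. -/
theorem abs_frobeniusInner_mul_transpose_le {d₁ d₂ : ℕ} {k : Type*} [Fintype k] (hd₁ : 0 < d₁)
    (hd₂ : 0 < d₂) {ρ B : ℝ} {S : Matrix (Fin d₁) (Fin d₂) ℝ} (hS : S ∈ sparseSet d₁ d₂ ρ B)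
    (hB : 0 ≤ B) (a : Matrix (Fin d₁) k ℝ) (b : Matrix (Fin d₂) k ℝ) :
    |frobeniusInner (a * bᵀ) S| ≤
      B * ρ * √((d₁ : ℝ) * d₂) / 2 * (frobeniusSq a + frobeniusSq b) := by
  classical
  obtain ⟨hrow, hcol, hent⟩ := hS
  have h1 : 0 < √(d₁ : ℝ) := Real.sqrt_pos.2 (by exact_mod_cast hd₁)
  have h2 : 0 < √(d₂ : ℝ) := Real.sqrt_pos.2 (by exact_mod_cast hd₂)
  have s1 : √(d₁ : ℝ) ^ 2 = d₁ := Real.sq_sqrt (by positivity)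
  have s2 : √(d₂ : ℝ) ^ 2 = d₂ := Real.sq_sqrt (by positivity)
  have s12 : √((d₁ : ℝ) * d₂) = √(d₁ : ℝ) * √(d₂ : ℝ) := Real.sqrt_mul (by positivity) _
  set p := √(d₁ : ℝ)
  set q := √(d₂ : ℝ)
  let w : Fin d₁ → Fin d₂ → ℝ := fun i j => if S i j ≠ 0 then 1 else 0
  have hw0 : ∀ i j, 0 ≤ w i j := fun i j => by simp only [w]; split_ifs <;> norm_num
  have hwr : ∀ i, ∑ j, w i j ≤ ρ * d₂ := fun i => by
    rw [sum_support_eq_ncard (S i)]; exact hrow i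
  have hwc : ∀ j, ∑ i, w i j ≤ ρ * d₁ := fun j => by
    rw [sum_support_eq_ncard (fun i => S i j)]; exact hcol j
  have hSw : ∀ i j, |S i j| ≤ B * w i j := fun i j => by
    by_cases h : S i j = 0
    · simp [w, h]
    · simpa [w, h] using hent i j
  let A : Fin d₁ → ℝ := fun i => ∑ l, a i l ^ 2
  let C : Fin d₂ → ℝ := fun j => ∑ l, b j l ^ 2
  have hA0 : ∀ i, 0 ≤ A i := fun i => Finset.sum_nonneg fun _ _ => sq_nonneg _
  have hC0 : ∀ j, 0 ≤ C j := fun j => Finset.sum_nonneg fun _ _ => sq_nonneg _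
  have hab : ∀ i j, |(a * bᵀ) i j| ≤ (p / q * A i + q / p * C j) / 2 := by
    intro i j
    rw [mul_apply]
    refine (Finset.abs_sum_le_sum_abs _ _).trans ?_
    simp only [A, C, Finset.mul_sum, ← Finset.sum_add_distrib, Finset.sum_div]
    refine Finset.sum_le_sum fun l _ => ?_
    rw [transpose_apply, abs_mul, ← sq_abs (a i l), ← sq_abs (b j l)]
    have h3 := sq_nonneg (p * |a i l| - q * |b j l|)
    have h4 : (p / q * |a i l| ^ 2 + q / p * |b j l| ^ 2) / 2 - |a i l| * |b j l| =
        (p * |a i l| - q * |b j l|) ^ 2 / (2 * (p * q)) := by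
      field_simp
      ring
    have h5 : 0 ≤ (p * |a i l| - q * |b j l|) ^ 2 / (2 * (p * q)) := by positivity
    linarith
  calc |frobeniusInner (a * bᵀ) S|
      ≤ ∑ i, ∑ j, (p / q * A i + q / p * C j) / 2 * (B * w i j) := by
        refine (Finset.abs_sum_le_sum_abs _ _).trans (Finset.sum_le_sum fun i _ => ?_)
        refine (Finset.abs_sum_le_sum_abs _ _).trans (Finset.sum_le_sum fun j _ => ?_)
        rw [abs_mul]
        exact mul_le_mul (hab i j) (hSw i j) (abs_nonneg _)
          ((abs_nonneg _).trans (hab i j))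
    _ = B / 2 * (p / q * ∑ i, A i * ∑ j, w i j + q / p * ∑ j, C j * ∑ i, w i j) := by
        have e : ∑ j, C j * ∑ i, w i j = ∑ i, ∑ j, C j * w i j := by
          simp only [Finset.mul_sum]
          exact Finset.sum_comm
        rw [e]
        simp only [Finset.mul_sum, ← Finset.sum_add_distrib]
        exact Finset.sum_congr rfl fun i _ => Finset.sum_congr rfl fun j _ => by ring
    _ ≤ B / 2 * (p / q * ∑ i, A i * (ρ * d₂) + q / p * ∑ j, C j * (ρ * d₁)) := by
        have i1 : ∑ i, A i * ∑ j, w i j ≤ ∑ i, A i * (ρ * d₂) :=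
          Finset.sum_le_sum fun i _ => mul_le_mul_of_nonneg_left (hwr i) (hA0 i)
        have i2 : ∑ j, C j * ∑ i, w i j ≤ ∑ j, C j * (ρ * d₁) :=
          Finset.sum_le_sum fun j _ => mul_le_mul_of_nonneg_left (hwc j) (hC0 j)
        gcongr
    _ = B * ρ * √((d₁ : ℝ) * d₂) / 2 * (frobeniusSq a + frobeniusSq b) := by
        rw [← Finset.sum_mul, ← Finset.sum_mul, s12, ← s1, ← s2]
        simp only [A, C, frobeniusSq]
        field_simp

/-- Pairing a sparse matrix with `P bᵀ`, where the rows of `P` are short: by Cauchy-Schwarz only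
the entries of `P bᵀ` on the support count. -/
theorem frobeniusInner_mul_transpose_sq_le {d₁ d₂ : ℕ} {k : Type*} [Fintype k]
    {ρ ν : ℝ} {S : Matrix (Fin d₁) (Fin d₂) ℝ}
    (hS : ∀ j, ({i | S i j ≠ 0}.ncard : ℝ) ≤ ρ * d₁)
    (P : Matrix (Fin d₁) k ℝ) (b : Matrix (Fin d₂) k ℝ) (hP : ∀ i, ∑ l, P i l ^ 2 ≤ ν)
    (hν : 0 ≤ ν) :
    frobeniusInner (P * bᵀ) S ^ 2 ≤ frobeniusSq S * (ν * (ρ * d₁) * frobeniusSq b) := by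
  classical
  let w : Fin d₁ → Fin d₂ → ℝ := fun i j => if S i j ≠ 0 then 1 else 0
  have hw0 : ∀ i j, 0 ≤ w i j := fun i j => by simp only [w]; split_ifs <;> norm_num
  have hww : ∀ i j, w i j ^ 2 = w i j := fun i j => by simp only [w]; split_ifs <;> norm_num
  have hSw : ∀ i j, S i j * w i j = S i j := fun i j => by
    by_cases h : S i j = 0 <;> simp [w, h]
  have hwc : ∀ j, ∑ i, w i j ≤ ρ * d₁ := fun j => by
    rw [sum_support_eq_ncard (fun i => S i j)]; exact hS j
  have hb0 : ∀ j, 0 ≤ ∑ l, b j l ^ 2 := fun j => Finset.sum_nonneg fun _ _ => sq_nonneg _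
  have e1 : frobeniusInner (P * bᵀ) S =
      ∑ x : Fin d₁ × Fin d₂, S x.1 x.2 * (w x.1 x.2 * (P * bᵀ) x.1 x.2) := by
    rw [Fintype.sum_prod_type]
    exact Finset.sum_congr rfl fun i _ => Finset.sum_congr rfl fun j _ => by
      rw [← mul_assoc, hSw, mul_comm]
  have e2 : frobeniusSq S = ∑ x : Fin d₁ × Fin d₂, S x.1 x.2 ^ 2 := by
    rw [Fintype.sum_prod_type]; rfl
  rw [e1]
  refine (Finset.sum_mul_sq_le_sq_mul_sq _ _ _).trans ?_
  rw [← e2]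
  refine mul_le_mul_of_nonneg_left ?_ (frobeniusSq_nonneg S)
  rw [Fintype.sum_prod_type_right]
  calc ∑ j, ∑ i, (w i j * (P * bᵀ) i j) ^ 2
      ≤ ∑ j, ∑ i, w i j * (ν * ∑ l, b j l ^ 2) := by
        refine Finset.sum_le_sum fun j _ => Finset.sum_le_sum fun i _ => ?_
        rw [mul_pow, hww]
        refine mul_le_mul_of_nonneg_left ?_ (hw0 i j)
        rw [mul_apply]
        refine (Finset.sum_mul_sq_le_sq_mul_sq _ _ _).trans ?_
        exact mul_le_mul_of_nonneg_right (hP i) (hb0 j)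
    _ ≤ ∑ j, (ρ * d₁) * (ν * ∑ l, b j l ^ 2) := by
        refine Finset.sum_le_sum fun j _ => ?_
        rw [← Finset.sum_mul]
        exact mul_le_mul_of_nonneg_right (hwc j) (mul_nonneg hν (hb0 j))
    _ = ν * (ρ * d₁) * frobeniusSq b := by
        rw [← Finset.mul_sum, ← Finset.mul_sum]
        simp only [frobeniusSq]
        ring

theorem sub_mem_sparseSet {d₁ d₂ : ℕ} {a a' B B' : ℝ} {S S' : Matrix (Fin d₁) (Fin d₂) ℝ}
    (hS : S ∈ sparseSet d₁ d₂ a B) (hS' : S' ∈ sparseSet d₁ d₂ a' B') :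
    S - S' ∈ sparseSet d₁ d₂ (a + a') (B + B') := by
  obtain ⟨h1, h2, h3⟩ := hS
  obtain ⟨h1', h2', h3'⟩ := hS'
  have key : ∀ {d : ℕ} (f g : Fin d → ℝ), ({j | f j - g j ≠ 0}.ncard : ℝ) ≤
      ({j | f j ≠ 0}.ncard : ℝ) + ({j | g j ≠ 0}.ncard : ℝ) := by
    intro d f g
    have hsub : {j | f j - g j ≠ 0} ⊆ {j | f j ≠ 0} ∪ {j | g j ≠ 0} := by
      intro j hj
      by_contra h
      simp only [Set.mem_union, Set.mem_ofPred_eq, not_or, not_not] at h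
      exact hj (by rw [h.1, h.2, sub_zero])
    exact_mod_cast (Set.ncard_le_ncard hsub (Set.toFinite _)).trans (Set.ncard_union_le _ _)
  refine ⟨fun i => ?_, fun j => ?_, fun i j => ?_⟩
  · exact (key _ _).trans (by linarith [h1 i, h1' i])
  · exact (key (fun i => S i j) (fun i => S' i j)).trans (by linarith [h2 j, h2' j])
  · exact (abs_sub _ _).trans (add_le_add (h3 i j) (h3' i j))

end Sparse

/-! ### Aligned factorizations of an incoherent matrix -/

section Incoherent

variable {d₁ d₂ r : ℕ} {μ : ℝ} {M : Matrix (Fin d₁) (Fin d₂) ℝ}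

theorem sigmaR_pos (hr : 0 < r) (h : IsIncoherent r μ M) : 0 < sigmaR r M := by
  unfold sigmaR singularValue
  rw [LinearMap.singularValues_pos_iff_lt_finrank_range]
  have hM := h.1
  rw [Matrix.rank_eq_finrank_range_toLin M (PiLp.basisFun 2 ℝ (Fin d₁))
    (PiLp.basisFun 2 ℝ (Fin d₂)), ← toLpLin_eq_toLin] at hM
  exact (Nat.sub_lt hr one_pos).trans_eq hM.symm

theorem sigmaR_le_singularValue {i : ℕ} (hi : i < r) : sigmaR r M ≤ singularValue M i :=
  LinearMap.singularValues_antitone _ (by omega)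

theorem singularValue_le_sigmaOne (i : ℕ) : singularValue M i ≤ sigmaOne M :=
  LinearMap.singularValues_antitone _ (Nat.zero_le i)

theorem sum_sq_le_of_norm_le {d : ℕ} {x : Fin d → ℝ} {c : ℝ} (hc : 0 ≤ c)
    (h : ‖WithLp.toLp 2 x‖ ≤ √c) : ∑ l, x l ^ 2 ≤ c := by
  have h1 : ‖WithLp.toLp 2 x‖ ^ 2 = ∑ l, x l ^ 2 := EuclideanSpace.real_norm_sq_eq _
  rw [← h1, ← Real.sq_sqrt hc]
  gcongr

theorem exists_ne_zero_of_orthonormal {d : ℕ} (hr : 0 < r) {X : Matrix (Fin d) (Fin r) ℝ}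
    (hX : Xᵀ * X = 1) : ∃ i, X i ≠ 0 := by
  by_contra! h
  have h0 : X = 0 := funext h
  rw [h0, Matrix.mul_zero] at hX
  simpa using congrFun (congrFun hX ⟨0, hr⟩) ⟨0, hr⟩

/-- Incoherence of a matrix of positive rank excludes the degenerate parameters. -/
theorem dims_pos (hr : 0 < r) (h : IsIncoherent r μ M) : 0 < d₁ ∧ 0 < d₂ ∧ 0 ≤ μ := by
  obtain ⟨-, X, D, Y, hsvd, hX, -⟩ := h
  obtain ⟨i, hi⟩ := exists_ne_zero_of_orthonormal hr hsvd.left_orthonormal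
  obtain ⟨j, -⟩ := exists_ne_zero_of_orthonormal hr hsvd.right_orthonormal
  refine ⟨i.pos, j.pos, ?_⟩
  by_contra! hμ
  have hle : μ * r / d₁ ≤ 0 :=
    div_nonpos_of_nonpos_of_nonneg (mul_nonpos_of_nonpos_of_nonneg hμ.le (by positivity))
      (by positivity)
  have h1 := hX i
  rw [Real.sqrt_eq_zero_of_nonpos hle] at h1
  have h2 := norm_le_zero_iff.1 h1
  exact hi (by simpa using congrArg WithLp.ofLp h2)

/-- A balanced factorization `M = P Qᵀ` obtained from the reduced singular value decomposition and
aligned with a given pair `(U, V)` by an orthogonal change of basis. -/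
theorem exists_aligned_factorization (hr : 0 < r) (h : IsIncoherent r μ M)
    (U : Matrix (Fin d₁) (Fin r) ℝ) (V : Matrix (Fin d₂) (Fin r) ℝ) :
    ∃ (P : Matrix (Fin d₁) (Fin r) ℝ) (Q : Matrix (Fin d₂) (Fin r) ℝ),
      P * Qᵀ = M ∧ Pᵀ * P = Qᵀ * Q ∧ (Pᵀ * U + Qᵀ * V).PosSemidef ∧
      (Pᵀ * P - sigmaR r M • (1 : Matrix (Fin r) (Fin r) ℝ)).PosSemidef ∧
      (∀ i, ∑ l, P i l ^ 2 ≤ sigmaOne M * (μ * r / d₁)) ∧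
      (∀ j, ∑ l, Q j l ^ 2 ≤ sigmaOne M * (μ * r / d₂)) := by
  obtain ⟨hd₁, hd₂, hμ⟩ := dims_pos hr h
  obtain ⟨-, X, D, Y, hsvd, hX, hY⟩ := h
  have hσ0 : ∀ i, 0 ≤ singularValue M i := fun i => LinearMap.singularValues_nonneg _ i
  let s : Matrix (Fin r) (Fin r) ℝ := Matrix.diagonal fun i : Fin r => √(singularValue M i)
  have hsT : sᵀ = s := diagonal_transpose _
  have hss : s * s = D := by
    rw [hsvd.diag_eq]
    simp only [s, diagonal_mul_diagonal]
    congr 1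
    funext i
    exact Real.mul_self_sqrt (hσ0 i)
  obtain ⟨R, hR, hpsd⟩ :=
    exists_orthogonal_transpose_mul_posSemidef ((X * s)ᵀ * U + (Y * s)ᵀ * V)
  have hR' : R * Rᵀ = 1 := mul_eq_one_comm.1 hR
  have gram : ∀ {d : ℕ} (Z : Matrix (Fin d) (Fin r) ℝ), Zᵀ * Z = 1 →
      (Z * s * R)ᵀ * (Z * s * R) = Rᵀ * D * R := by
    intro d Z hZ
    rw [transpose_mul, transpose_mul, hsT, ← hss]
    calc Rᵀ * (s * Zᵀ) * (Z * s * R) = Rᵀ * (s * (Zᵀ * Z) * s) * R := by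
          simp only [Matrix.mul_assoc]
      _ = _ := by rw [hZ, Matrix.mul_one]
  have row : ∀ {d : ℕ} (Z : Matrix (Fin d) (Fin r) ℝ) (c : ℝ) (i : Fin d), 0 ≤ c →
      ‖WithLp.toLp 2 (Z i)‖ ≤ √c → ∑ l, (Z * s * R) i l ^ 2 ≤ sigmaOne M * c := by
    intro d Z c i hc hZ
    have e1 : ∑ l, (Z * s * R) i l ^ 2 = ((Z * s * R) * (Z * s * R)ᵀ) i i := by
      rw [mul_apply]
      exact Finset.sum_congr rfl fun l _ => pow_two _
    have e2 : (Z * s * R) * (Z * s * R)ᵀ = (Z * s) * (Z * s)ᵀ := by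
      rw [transpose_mul (Z * s), Matrix.mul_assoc (Z * s), ← Matrix.mul_assoc R, hR',
        Matrix.one_mul]
    rw [e1, e2, mul_apply]
    calc ∑ l, (Z * s) i l * (Z * s)ᵀ l i = ∑ l : Fin r, singularValue M l * Z i l ^ 2 := by
          refine Finset.sum_congr rfl fun l _ => ?_
          rw [transpose_apply, mul_diagonal]
          have := Real.mul_self_sqrt (hσ0 l)
          linear_combination (Z i l) ^ 2 * this
      _ ≤ ∑ l, sigmaOne M * Z i l ^ 2 := by
          gcongr with l _
          exact singularValue_le_sigmaOne _
      _ = sigmaOne M * ∑ l, Z i l ^ 2 := by rw [Finset.mul_sum]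
      _ ≤ sigmaOne M * c := by
          have : 0 ≤ sigmaOne M := hσ0 0
          gcongr
          exact sum_sq_le_of_norm_le hc hZ
  refine ⟨X * s * R, Y * s * R, ?_, ?_, ?_, ?_, ?_, ?_⟩
  · rw [transpose_mul, transpose_mul, hsT, hsvd.eq_mul, ← hss]
    calc X * s * R * (Rᵀ * (s * Yᵀ)) = X * s * (R * Rᵀ) * (s * Yᵀ) := by
          simp only [Matrix.mul_assoc]
      _ = _ := by rw [hR', Matrix.mul_one]; simp only [Matrix.mul_assoc]
  · rw [gram X hsvd.left_orthonormal, gram Y hsvd.right_orthonormal]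
  · have e : (X * s * R)ᵀ * U + (Y * s * R)ᵀ * V = Rᵀ * ((X * s)ᵀ * U + (Y * s)ᵀ * V) := by
      rw [transpose_mul (X * s), transpose_mul (Y * s), Matrix.mul_add, Matrix.mul_assoc,
        Matrix.mul_assoc]
    rw [e]
    exact hpsd
  · have e : (X * s * R)ᵀ * (X * s * R) - sigmaR r M • (1 : Matrix (Fin r) (Fin r) ℝ) =
        Rᴴ * (Matrix.diagonal fun i : Fin r => singularValue M i - sigmaR r M) * R := by
      have e1 : (Matrix.diagonal fun i : Fin r => singularValue M i - sigmaR r M) =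
          D - sigmaR r M • (1 : Matrix (Fin r) (Fin r) ℝ) := by
        rw [hsvd.diag_eq, smul_one_eq_diagonal, diagonal_sub]
      rw [gram X hsvd.left_orthonormal, e1, conjTranspose_eq_transpose_of_trivial,
        Matrix.mul_sub, Matrix.sub_mul, Matrix.mul_smul, Matrix.mul_one, Matrix.smul_mul, hR]
    rw [e]
    refine PosSemidef.conjTranspose_mul_mul_same (PosSemidef.diagonal fun i => ?_) R
    exact sub_nonneg.2 (sigmaR_le_singularValue i.2)
  · exact fun i => row X _ i (by positivity) (hX i)
  · exact fun j => row Y _ j (by positivity) (hY j)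

end Incoherent

/-! ### The polynomial majorants of the objective -/

section Majorant

variable {d₁ d₂ r : ℕ}

/-- The objective with the sparse part frozen at `S`: a polynomial in `(U, V)` that lies above the
objective as soon as `S` is feasible. -/
noncomputable def majorant (Mo S : Matrix (Fin d₁) (Fin d₂) ℝ) (W : Pairs d₁ d₂ r) : ℝ :=
  fitLoss Mo W S + 1 / 8 * frobeniusSq ((matU W)ᵀ * matU W - (matV W)ᵀ * matV W)

theorem contDiff_mul_transpose_apply (i : Fin d₁) (j : Fin d₂) :
    ContDiff ℝ ((⊤ : ℕ∞) : WithTop ℕ∞)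
      fun W : Pairs d₁ d₂ r => (matU W * (matV W)ᵀ) i j := by
  simp only [mul_apply, matU, matV, transpose_apply, of_apply]
  fun_prop

theorem contDiff_majorant (Mo S : Matrix (Fin d₁) (Fin d₂) ℝ) :
    ContDiff ℝ ((⊤ : ℕ∞) : WithTop ℕ∞) (majorant Mo S : Pairs d₁ d₂ r → ℝ) := by
  unfold majorant fitLoss frobeniusSq
  simp only [Matrix.add_apply, Matrix.sub_apply, mul_apply, matU, matV, transpose_apply, of_apply]
  fun_prop

theorem objective_le_majorant {a B : ℝ} (ha : 0 ≤ a) (hB : 0 ≤ B)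
    {Mo S : Matrix (Fin d₁) (Fin d₂) ℝ} (hS : S ∈ sparseSet d₁ d₂ a B) (W : Pairs d₁ d₂ r) :
    objective r a B Mo W ≤ majorant Mo S W := by
  have := (minFitLoss_isLeast ha hB Mo W).2 ⟨S, hS, rfl⟩
  unfold objective majorant
  linarith

theorem exists_majorant_eq_objective {a B : ℝ} (ha : 0 ≤ a) (hB : 0 ≤ B)
    (Mo : Matrix (Fin d₁) (Fin d₂) ℝ) (W : Pairs d₁ d₂ r) :
    ∃ S ∈ sparseSet d₁ d₂ a B, majorant Mo S W = objective r a B Mo W := by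
  obtain ⟨S, hS, h⟩ := (minFitLoss_isLeast ha hB Mo W).1
  exact ⟨S, hS, by unfold objective majorant; rw [h]⟩

/-- Up to a constant, the majorant is affine in the sparse part. -/
theorem majorant_eq_add (Mo S : Matrix (Fin d₁) (Fin d₂) ℝ) (W : Pairs d₁ d₂ r) :
    majorant Mo S W = majorant Mo 0 W +
      ∑ i, ∑ j, S i j * ((matU W * (matV W)ᵀ) i j - Mo i j) + 1 / 2 * frobeniusSq S := by
  have h1 : matU W * (matV W)ᵀ + S - Mo = (matU W * (matV W)ᵀ - Mo) + S := by abel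
  have h2 : frobeniusInner (matU W * (matV W)ᵀ - Mo) S =
      ∑ i, ∑ j, S i j * ((matU W * (matV W)ᵀ) i j - Mo i j) := by
    rw [frobeniusInner_comm]; rfl
  unfold majorant fitLoss
  rw [h1, frobeniusSq_add, h2, add_zero]
  ring

/-- At a point where the objective is not differentiable, two optimal choices of the sparse part
have different gradients. -/
theorem differentiableAt_objective_or {a B : ℝ} (ha : 0 ≤ a) (hB : 0 ≤ B)
    (Mo : Matrix (Fin d₁) (Fin d₂) ℝ) (x : Pairs d₁ d₂ r) :
    DifferentiableAt ℝ (objective r a B Mo) x ∨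
      ∃ S₁ ∈ sparseSet d₁ d₂ a B, ∃ S₂ ∈ sparseSet d₁ d₂ a B,
        majorant Mo S₁ x = objective r a B Mo x ∧ majorant Mo S₂ x = objective r a B Mo x ∧
        fderiv ℝ (majorant Mo S₁) x ≠ fderiv ℝ (majorant Mo S₂) x := by
  let m : Fin d₁ → Fin d₂ → Pairs d₁ d₂ r → ℝ := fun i j W => (matU W * (matV W)ᵀ) i j
  have hm : ∀ i j, HasFDerivAt (m i j) (fderiv ℝ (m i j) x) x := fun i j =>
    ((contDiff_mul_transpose_apply i j).differentiable (by simp) x).hasFDerivAt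
  have h0 : HasFDerivAt (majorant Mo 0) (fderiv ℝ (majorant Mo 0) x) x :=
    ((contDiff_majorant Mo 0).differentiable (by simp) x).hasFDerivAt
  let D : Matrix (Fin d₁) (Fin d₂) ℝ → Pairs d₁ d₂ r →L[ℝ] ℝ := fun S =>
    fderiv ℝ (majorant Mo 0) x + ∑ i, ∑ j, S i j • fderiv ℝ (m i j) x
  have hD : ∀ S, fderiv ℝ (majorant Mo S) x = D S := by
    intro S
    have hs : HasFDerivAt (fun W => majorant Mo 0 W +
        ∑ i, ∑ j, S i j * (m i j W - Mo i j) + 1 / 2 * frobeniusSq S) (D S) x := by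
      refine (h0.fun_add ?_).add_const _
      refine HasFDerivAt.fun_sum fun i _ => HasFDerivAt.fun_sum fun j _ => ?_
      exact ((hm i j).sub_const _).const_mul _
    rw [← hs.fderiv]
    congr 1
    exact funext fun W => majorant_eq_add Mo S W
  have hDc : Continuous D := by
    refine continuous_const.add ?_
    refine continuous_finsetSum _ fun i _ => continuous_finsetSum _ fun j _ => ?_
    have hc : Continuous fun S : Matrix (Fin d₁) (Fin d₂) ℝ => S i j := by fun_prop
    exact hc.smul continuous_const
  have hGc : Continuous fun S => majorant Mo S x := by
    unfold majorant fitLoss frobeniusSq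
    fun_prop
  let R : (Pairs d₁ d₂ r → ℝ) → Pairs d₁ d₂ r → ℝ := fun f h => f (x + h) - f x - fderiv ℝ f x h
  let ρ : Pairs d₁ d₂ r → ℝ := fun h => |R (majorant Mo 0) h| + ∑ i, ∑ j, B * |R (m i j) h|
  have hρ : ρ =o[𝓝 0] fun h : Pairs d₁ d₂ r => h := by
    refine Asymptotics.IsLittleO.add ?_ (Asymptotics.IsLittleO.fun_sum fun i _ =>
      Asymptotics.IsLittleO.fun_sum fun j _ => Asymptotics.IsLittleO.const_mul_left ?_ _)
    · exact (hasFDerivAt_iff_isLittleO_nhds_zero.1 h0).norm_left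
    · exact (hasFDerivAt_iff_isLittleO_nhds_zero.1 (hm i j)).norm_left
  have hG : ∀ S ∈ sparseSet d₁ d₂ a B, ∀ h,
      |majorant Mo S (x + h) - majorant Mo S x - D S h| ≤ ρ h := by
    intro S hS h
    have e : majorant Mo S (x + h) - majorant Mo S x - D S h =
        R (majorant Mo 0) h + ∑ i, ∑ j, S i j * R (m i j) h := by
      rw [majorant_eq_add Mo S (x + h), majorant_eq_add Mo S x]
      simp only [D, R, m, _root_.add_apply, _root_.sum_apply, _root_.smul_apply,
        smul_eq_mul, mul_sub, Finset.sum_sub_distrib]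
      ring
    rw [e]
    refine (abs_add_le _ _).trans (add_le_add le_rfl ?_)
    refine (Finset.abs_sum_le_sum_abs _ _).trans (Finset.sum_le_sum fun i _ => ?_)
    refine (Finset.abs_sum_le_sum_abs _ _).trans (Finset.sum_le_sum fun j _ => ?_)
    rw [abs_mul]
    exact mul_le_mul_of_nonneg_right (hS.2.2 i j) (abs_nonneg _)
  have := differentiableAt_or_exists_ne (isCompact_sparseSet d₁ d₂ a B) hGc hDc hG hρ
    (fun S hS y => objective_le_majorant ha hB hS y)
    (fun y => exists_majorant_eq_objective ha hB Mo y)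
  simpa only [hD] using this

theorem norm_sq_eq_frobeniusSq (W : Pairs d₁ d₂ r) :
    ‖W‖ ^ 2 = frobeniusSq (matU W) + frobeniusSq (matV W) := by
  rw [EuclideanSpace.real_norm_sq_eq, Fintype.sum_prod_type, Fintype.sum_sum_type]
  rfl

/-- The pair with components `P` and `Q`. -/
noncomputable def ofMatrices (P : Matrix (Fin d₁) (Fin r) ℝ) (Q : Matrix (Fin d₂) (Fin r) ℝ) : Pairs d₁ d₂ r :=
  WithLp.toLp 2 fun x => Sum.elim (fun i => P i x.2) (fun j => Q j x.2) x.1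

theorem matU_ofMatrices (P : Matrix (Fin d₁) (Fin r) ℝ) (Q : Matrix (Fin d₂) (Fin r) ℝ) :
    matU (ofMatrices P Q) = P := rfl

theorem matV_ofMatrices (P : Matrix (Fin d₁) (Fin r) ℝ) (Q : Matrix (Fin d₂) (Fin r) ℝ) :
    matV (ofMatrices P Q) = Q := rfl

theorem matU_add_smul (Z W : Pairs d₁ d₂ r) (s : ℝ) : matU (Z + s • W) = matU Z + s • matU W := by
  ext; simp [matU]

theorem matV_add_smul (Z W : Pairs d₁ d₂ r) (s : ℝ) : matV (Z + s • W) = matV Z + s • matV W := by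
  ext; simp [matV]

/-- Along a ray from a balanced factorization `Z` of `M`, the majorant is the squared norm of an
affine-plus-quadratic residual. -/
theorem majorant_ray {M S₀ S : Matrix (Fin d₁) (Fin d₂) ℝ} {Z : Pairs d₁ d₂ r}
    (hZ : matU Z * (matV Z)ᵀ = M) (hbal : (matU Z)ᵀ * matU Z = (matV Z)ᵀ * matV Z)
    (W : Pairs d₁ d₂ r) (s : ℝ) :
    majorant (M + S₀) S (Z + s • W) =
      1 / 2 * frobeniusSq (s • (matU Z * (matV W)ᵀ + matU W * (matV Z)ᵀ) +
        s ^ 2 • (matU W * (matV W)ᵀ) + (S - S₀)) +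
      1 / 8 * frobeniusSq (s • ((matU Z)ᵀ * matU W + ((matU Z)ᵀ * matU W)ᵀ - (matV Z)ᵀ * matV W -
        ((matV Z)ᵀ * matV W)ᵀ) +
        s ^ 2 • ((matU W)ᵀ * matU W - (matV W)ᵀ * matV W) + 0) := by
  have e1 : (matU Z + s • matU W) * (matV Z + s • matV W)ᵀ + S - (M + S₀) =
      s • (matU Z * (matV W)ᵀ + matU W * (matV Z)ᵀ) +
        s ^ 2 • (matU W * (matV W)ᵀ) + (S - S₀) := by
    rw [← hZ, transpose_add, transpose_smul, Matrix.add_mul, Matrix.mul_add, Matrix.mul_add,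
      Matrix.smul_mul, Matrix.smul_mul, Matrix.mul_smul, Matrix.mul_smul]
    module
  have e2 : (matU Z + s • matU W)ᵀ * (matU Z + s • matU W) -
      (matV Z + s • matV W)ᵀ * (matV Z + s • matV W) =
      s • ((matU Z)ᵀ * matU W + ((matU Z)ᵀ * matU W)ᵀ - (matV Z)ᵀ * matV W -
        ((matV Z)ᵀ * matV W)ᵀ) +
        s ^ 2 • ((matU W)ᵀ * matU W - (matV W)ᵀ * matV W) + 0 := by
    simp only [transpose_add, transpose_smul, Matrix.add_mul, Matrix.mul_add, Matrix.smul_mul,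
      Matrix.mul_smul, hbal, transpose_mul, transpose_transpose]
    module
  unfold majorant fitLoss
  rw [matU_add_smul, matV_add_smul, e1, e2]

end Majorant

/-! ### Curvature towards the nearest global minimum -/

/-- The perturbation caused by the sparse error is a small fraction of the residual `q`. Here `x` and
`y` stand for the two parts of `⟨L, E⟩`, `z` for `⟨B, E⟩` and `e` for `‖E‖²`. The factor `30000` makes
`|x + y| ≤ q / 25`. -/
theorem perturbation_le {σ δ q Na Nb x y z e : ℝ} (hNa : 0 ≤ Na) (hNb : 0 ≤ Nb) (hq : 0 ≤ q)
    (hδ0 : 0 ≤ δ) (hδ : 30000 * δ ≤ σ) (hN : σ * (Na + Nb) ≤ 3 * q) (he : e ≤ 4 * q)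
    (hx : x ^ 2 ≤ e * (2 * δ * Nb)) (hy : y ^ 2 ≤ e * (2 * δ * Na))
    (hz : |z| ≤ 4 * δ * (Na + Nb)) : -4 * (x + y) - 6 * z ≤ 1 / 2 * q := by
  have hδN : δ * (Na + Nb) ≤ q / 10000 := by nlinarith [add_nonneg hNa hNb]
  have hδN0 : 0 ≤ δ * (Na + Nb) := mul_nonneg hδ0 (add_nonneg hNa hNb)
  have h1 : (x + y) ^ 2 ≤ (q / 25) ^ 2 := by
    have h2 : (x + y) ^ 2 ≤ 4 * e * (δ * (Na + Nb)) := by nlinarith [sq_nonneg (x - y)]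
    have h3 : 4 * e * (δ * (Na + Nb)) ≤ 16 * q * (δ * (Na + Nb)) := by nlinarith
    have h4 : 16 * q * (δ * (Na + Nb)) ≤ 16 * q * (q / 10000) := by gcongr
    nlinarith
  have h5 := abs_le.1 (abs_le_of_sq_le_sq h1 (by positivity))
  have h6 := abs_le.1 hz
  linarith [h5.1, h6.1]

section Geometry

variable {d₁ d₂ r : ℕ} {μ α γ : ℝ} {M S₀ S : Matrix (Fin d₁) (Fin d₂) ℝ}

/-- Over a nonempty index set, the sparse set of a negative density is empty. -/
theorem density_nonneg (hd₂ : 0 < d₂) (hd₁ : 0 < d₁) {a B : ℝ} (hS : S ∈ sparseSet d₁ d₂ a B) :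
    0 ≤ a := by
  have h := (Nat.cast_nonneg _).trans (hS.1 ⟨0, hd₁⟩)
  exact nonneg_of_mul_nonneg_left h (by exact_mod_cast hd₂)

theorem entryBound_nonneg (hμ : 0 ≤ μ) : 0 ≤ entryBound r μ M := by
  have : 0 ≤ sigmaOne M := LinearMap.singularValues_nonneg _ 0
  unfold entryBound
  positivity

/-- The curvature estimate at the level of matrices: with `W = (P + a, Q + b)` aligned to the
balanced factorization `(P, Q)` of `M`, the loss at `(P, Q) + (1 + t) (a, b)` is a quartic polynomial
in `t` whose second derivative at `0` is bounded by its slope minus a multiple of `‖(a, b)‖²`. -/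
theorem exists_quartic_of_aligned (hd₁ : 0 < d₁) (hd₂ : 0 < d₂) (hμ : 0 ≤ μ) (hα : 0 ≤ α)
    (hγ : 1 ≤ γ) {P a : Matrix (Fin d₁) (Fin r) ℝ} {Q b : Matrix (Fin d₂) (Fin r) ℝ}
    (hbal : Pᵀ * P = Qᵀ * Q) (hal : (Pᵀ * (P + a) + Qᵀ * (Q + b)).PosSemidef)
    (hK : (Pᵀ * P - sigmaR r M • (1 : Matrix (Fin r) (Fin r) ℝ)).PosSemidef)
    (hrowP : ∀ i, ∑ l, P i l ^ 2 ≤ sigmaOne M * (μ * r / d₁))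
    (hrowQ : ∀ j, ∑ l, Q j l ^ 2 ≤ sigmaOne M * (μ * r / d₂))
    (hδ : 30000 * (γ * α * (μ * r) * sigmaOne M) ≤ sigmaR r M)
    {N : Matrix (Fin d₁) (Fin d₂) ℝ}
    (hN : N ∈ sparseSet d₁ d₂ (2 * (γ * α)) (2 * entryBound r μ M))
    (hopt : frobeniusSq (P * bᵀ + a * Qᵀ + a * bᵀ + N) ≤
      frobeniusSq (P * bᵀ + a * Qᵀ + a * bᵀ)) :
    ∃ a₀ a₁ a₂ a₃ a₄ : ℝ,
      (∀ t : ℝ,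
        1 / 2 * frobeniusSq ((1 + t) • (P * bᵀ + a * Qᵀ) + (1 + t) ^ 2 • (a * bᵀ) + N) +
          1 / 8 * frobeniusSq ((1 + t) • (Pᵀ * a + (Pᵀ * a)ᵀ - Qᵀ * b - (Qᵀ * b)ᵀ) +
            (1 + t) ^ 2 • (aᵀ * a - bᵀ * b) + 0) =
          a₀ + a₁ * t + a₂ * t ^ 2 + a₃ * t ^ 3 + a₄ * t ^ 4) ∧
      2 * a₂ ≤ 4 * a₁ - sigmaR r M / 6 * (frobeniusSq a + frobeniusSq b) := by
  have hd₁' : (0 : ℝ) < d₁ := by exact_mod_cast hd₁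
  have hd₂' : (0 : ℝ) < d₂ := by exact_mod_cast hd₂
  have hσ₁ : 0 ≤ sigmaOne M := LinearMap.singularValues_nonneg _ 0
  have hquad := quadratic_le_residual P a Q b hbal hal
  have hdist := distance_le_residual P a Q b hbal hal
  set δ := γ * α * (μ * r) * sigmaOne M with hδdef
  have hδ0 : 0 ≤ δ := by positivity
  have hEA := frobeniusSq_le_of_add_le hopt
  have hBE := abs_frobeniusInner_mul_transpose_le hd₁ hd₂ hN
    (mul_nonneg zero_le_two (entryBound_nonneg hμ)) a b
  have hBEc : 2 * entryBound r μ M * (2 * (γ * α)) * √((d₁ : ℝ) * d₂) / 2 = 4 * δ := by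
    have : 0 < √((d₁ : ℝ) * d₂) := Real.sqrt_pos.2 (by positivity)
    rw [entryBound, hδdef]
    field_simp
    ring
  rw [hBEc] at hBE
  have hLE₁ := frobeniusInner_mul_transpose_sq_le hN.2.1 P b hrowP (by positivity)
  have hLE₂ := frobeniusInner_mul_transpose_sq_le (S := Nᵀ) hN.1 Q a hrowQ (by positivity)
  have hc₁ : sigmaOne M * (μ * r / d₁) * (2 * (γ * α) * d₁) = 2 * δ := by
    rw [hδdef]; field_simp
  have hc₂ : sigmaOne M * (μ * r / d₂) * (2 * (γ * α) * d₂) = 2 * δ := by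
    rw [hδdef]; field_simp
  rw [hc₁] at hLE₁
  rw [hc₂, frobeniusSq_transpose, show Q * aᵀ = (a * Qᵀ)ᵀ by simp, frobeniusInner_transpose]
    at hLE₂
  have hdist' : sigmaR r M * (frobeniusSq a + frobeniusSq b) ≤
      ((aᵀ * a + bᵀ * b) * (Pᵀ * P)).trace := by
    have h := add_nonneg (trace_gram_mul_nonneg a hK) (trace_gram_mul_nonneg b hK)
    rw [← trace_add, ← Matrix.add_mul, Matrix.mul_sub, Matrix.mul_smul, Matrix.mul_one,
      trace_sub, trace_smul, trace_add, smul_eq_mul, ← frobeniusSq_eq_trace,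
      ← frobeniusSq_eq_trace] at h
    linarith
  have hq0 := frobeniusSq_nonneg (P * bᵀ + a * Qᵀ + a * bᵀ)
  have hq0' := frobeniusSq_nonneg
    (Pᵀ * a + (Pᵀ * a)ᵀ - Qᵀ * b - (Qᵀ * b)ᵀ + (aᵀ * a - bᵀ * b))
  have hpert := perturbation_le (q := frobeniusSq (P * bᵀ + a * Qᵀ + a * bᵀ) +
      1 / 4 * frobeniusSq (Pᵀ * a + (Pᵀ * a)ᵀ - Qᵀ * b - (Qᵀ * b)ᵀ + (aᵀ * a - bᵀ * b)))
    (frobeniusSq_nonneg a) (frobeniusSq_nonneg b) (by linarith) hδ0 hδ (by linarith)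
    (by linarith) hLE₁ hLE₂ hBE
  rw [← frobeniusInner_add_left] at hpert
  have hz : ∀ X : Matrix (Fin r) (Fin r) ℝ, frobeniusInner X 0 = 0 := by
    simp [frobeniusInner]
  have hz' : frobeniusSq (0 : Matrix (Fin r) (Fin r) ℝ) = 0 := by
    simp [frobeniusSq]
  generalize Pᵀ * a + (Pᵀ * a)ᵀ - Qᵀ * b - (Qᵀ * b)ᵀ = l at *
  generalize aᵀ * a - bᵀ * b = β at *
  generalize P * bᵀ + a * Qᵀ = L at *
  generalize a * bᵀ = B at *
  simp only [frobeniusSq_smul_add_smul_add, hz, hz']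
  rw [frobeniusSq_add] at hq0 hpert hquad hdist
  rw [frobeniusSq_add] at hq0' hpert hquad hdist
  -- The coefficients are the Taylor coefficients at `s = 1` of the quartic in `s = 1 + t`.
  refine ⟨1 / 2 * (frobeniusSq L + frobeniusSq B + frobeniusSq N + 2 * frobeniusInner L B +
      2 * frobeniusInner L N + 2 * frobeniusInner B N) +
      1 / 8 * (frobeniusSq l + frobeniusSq β + 2 * frobeniusInner l β),
    1 / 2 * (2 * frobeniusSq L + 4 * frobeniusSq B + 6 * frobeniusInner L B +
      2 * frobeniusInner L N + 4 * frobeniusInner B N) +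
      1 / 8 * (2 * frobeniusSq l + 4 * frobeniusSq β + 6 * frobeniusInner l β),
    1 / 2 * (frobeniusSq L + 6 * frobeniusSq B + 6 * frobeniusInner L B +
      2 * frobeniusInner B N) +
      1 / 8 * (frobeniusSq l + 6 * frobeniusSq β + 6 * frobeniusInner l β),
    1 / 2 * (4 * frobeniusSq B + 2 * frobeniusInner L B) +
      1 / 8 * (4 * frobeniusSq β + 2 * frobeniusInner l β),
    1 / 2 * frobeniusSq B + 1 / 8 * frobeniusSq β, fun t => by ring, ?_⟩
  linarith

/-- The direction from the nearest global minimum `Z` to `W` has negative curvature at `W`, up to a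
multiple of the slope in this direction. -/
theorem exists_direction_of_negative_curvature (hr : 0 < r) (hM : IsIncoherent r μ M)
    (hS₀ : S₀ ∈ sparseSet d₁ d₂ α (entryBound r μ M)) (hγ : 1 ≤ γ)
    (hδ : 30000 * (γ * α * (μ * r) * sigmaOne M) ≤ sigmaR r M)
    (hS : S ∈ sparseSet d₁ d₂ (γ * α) (entryBound r μ M)) (W : Pairs d₁ d₂ r)
    (hopt : majorant (M + S₀) S W ≤ majorant (M + S₀) S₀ W) :
    ∃ Z : Pairs d₁ d₂ r, matU Z * (matV Z)ᵀ = M ∧ (matU Z)ᵀ * matU Z = (matV Z)ᵀ * matV Z ∧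
      ∃ a₀ a₁ a₂ a₃ a₄ : ℝ,
        (∀ t : ℝ, majorant (M + S₀) S (W + t • (W - Z)) =
          a₀ + a₁ * t + a₂ * t ^ 2 + a₃ * t ^ 3 + a₄ * t ^ 4) ∧
        2 * a₂ ≤ 4 * a₁ - sigmaR r M / 6 * ‖W - Z‖ ^ 2 := by
  obtain ⟨hd₁, hd₂, hμ⟩ := dims_pos hr hM
  have hα := density_nonneg hd₂ hd₁ hS₀
  obtain ⟨P, Q, hPQ, hbal, hal, hK, hrowP, hrowQ⟩ :=
    exists_aligned_factorization hr hM (matU W) (matV W)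
  obtain ⟨Z, rfl, rfl⟩ : ∃ Z : Pairs d₁ d₂ r, matU Z = P ∧ matV Z = Q :=
    ⟨ofMatrices P Q, matU_ofMatrices P Q, matV_ofMatrices P Q⟩
  have hW : Z + (1 : ℝ) • (W - Z) = W := by rw [one_smul, add_sub_cancel]
  refine ⟨Z, hPQ, hbal, ?_⟩
  have hline : ∀ t : ℝ, W + t • (W - Z) = Z + (1 + t) • (W - Z) := fun t => by module
  have hUW := matU_add_smul Z (W - Z) 1
  have hVW := matV_add_smul Z (W - Z) 1
  rw [hW, one_smul] at hUW hVW
  rw [hUW, hVW] at hal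
  have hE : S - S₀ ∈ sparseSet d₁ d₂ (2 * (γ * α)) (2 * entryBound r μ M) := by
    obtain ⟨h1, h2, h3⟩ := sub_mem_sparseSet hS hS₀
    have hle : γ * α + α ≤ 2 * (γ * α) := by nlinarith
    exact ⟨fun i => (h1 i).trans (by gcongr), fun j => (h2 j).trans (by gcongr),
      fun i j => (h3 i j).trans (by linarith)⟩
  have h1 := majorant_ray (S₀ := S₀) (S := S) hPQ hbal (W - Z) 1
  have h0 := majorant_ray (S₀ := S₀) (S := S₀) hPQ hbal (W - Z) 1
  rw [hW] at h0 h1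
  rw [h0, h1] at hopt
  simp only [one_smul, one_pow, sub_self, add_zero] at hopt
  simp only [hline, majorant_ray hPQ hbal, norm_sq_eq_frobeniusSq]
  exact exists_quartic_of_aligned hd₁ hd₂ hμ hα hγ hbal hal hK hrowP hrowQ hδ hE (by linarith)

/-- A balanced factorization of `M` has objective value zero, so it is a global minimum. -/
theorem isLocalMin_objective_of_balanced {a B : ℝ} (ha : 0 ≤ a) (hB : 0 ≤ B) (hS₀ : S₀ ∈ sparseSet d₁ d₂ a B)
    {Z : Pairs d₁ d₂ r} (hZ : matU Z * (matV Z)ᵀ = M)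
    (hbal : (matU Z)ᵀ * matU Z = (matV Z)ᵀ * matV Z) :
    IsLocalMin (objective r a B (M + S₀)) Z := by
  refine Eventually.of_forall fun y => ?_
  obtain ⟨S, -, hS⟩ := exists_majorant_eq_objective ha hB (M + S₀) y
  refine (objective_le_majorant ha hB hS₀ Z).trans ?_
  rw [← hS]
  have h0 : majorant (M + S₀) S₀ Z = 0 := by
    simp [majorant, fitLoss, hZ, hbal, frobeniusSq]
  rw [h0]
  unfold majorant fitLoss
  have := frobeniusSq_nonneg (matU y * (matV y)ᵀ + S - (M + S₀))
  have := frobeniusSq_nonneg ((matU y)ᵀ * matU y - (matV y)ᵀ * matV y)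
  positivity

end Geometry

/-- First and second order necessary conditions for a quartic polynomial. -/
theorem quartic_isLocalMin {a₀ a₁ a₂ a₃ a₄ : ℝ}
    (h : IsLocalMin (fun t : ℝ => a₀ + a₁ * t + a₂ * t ^ 2 + a₃ * t ^ 3 + a₄ * t ^ 4) 0) :
    a₁ = 0 ∧ 0 ≤ a₂ := by
  have h1 : a₁ = 0 := by
    simpa using h.hasDerivAt_eq_zero (hasDerivAt_quartic a₀ a₁ a₂ a₃ a₄ 0)
  refine ⟨h1, ?_⟩
  have hev : ∀ᶠ t : ℝ in 𝓝[>] 0, 0 ≤ a₂ + a₃ * t + a₄ * t ^ 2 := by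
    filter_upwards [h.filter_mono nhdsWithin_le_nhds, self_mem_nhdsWithin] with t ht ht0
    have ht0' : (0 : ℝ) < t ^ 2 := pow_pos ht0 2
    refine nonneg_of_mul_nonneg_right (a := t ^ 2) ?_ ht0'
    rw [h1] at ht
    norm_num at ht
    linarith
  have hlim : Tendsto (fun t : ℝ => a₂ + a₃ * t + a₄ * t ^ 2) (𝓝[>] 0) (𝓝 a₂) := by
    have hc : Continuous fun t : ℝ => a₂ + a₃ * t + a₄ * t ^ 2 := by fun_prop
    have := (hc.tendsto 0).mono_left (nhdsWithin_le_nhds (s := Set.Ioi 0))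
    simpa using this
  exact ge_of_tendsto hlim hev

end RobustPCA

open RobustPCA in
theorem theorem3p3 :
    ∃ (c c₁ c₂ c₃ : ℝ) (k : ℕ), 0 < c ∧ 0 < c₁ ∧ 0 < c₂ ∧ 0 < c₃ ∧
      ∀ (d₁ d₂ r : ℕ) (Mstar Sstar : Matrix (Fin d₁) (Fin d₂) ℝ) (μ α γ : ℝ),
        0 < r →
        IsIncoherent r μ Mstar →
        Sstar ∈ sparseSet d₁ d₂ α (entryBound r μ Mstar) →
        c < γ →
        γ * α * (μ * r) * condNumber r Mstar ^ 5 ≤ 1 / c →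
        (∀ W : Pairs d₁ d₂ r,
          IsLocalMin (objective r (γ * α) (entryBound r μ Mstar) (Mstar + Sstar)) W →
            matU W * (matV W).transpose = Mstar) ∧
        (∀ ε : ℝ, 0 < ε →
          ε ≤ c₃ * (sigmaR r Mstar * √(sigmaR r Mstar)) / ((d₁ : ℝ) + d₂) ^ k →
          IsPseudoStrictSaddle
            (objective r (γ * α) (entryBound r μ Mstar) (Mstar + Sstar))
            ε (c₁ * sigmaR r Mstar)
            (c₂ * (ε * √(condNumber r Mstar) / sigmaR r Mstar))) := by
  refine ⟨30000, 1 / 12, 48, 1, 0, by norm_num, by norm_num, by norm_num, one_pos, ?_⟩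
  intro d₁ d₂ r M S₀ μ α γ hr hM hS₀ hγ hκ
  obtain ⟨hd₁, hd₂, hμ⟩ := dims_pos hr hM
  have hα := density_nonneg hd₂ hd₁ hS₀
  have hσ := sigmaR_pos hr hM
  have hγ1 : 1 ≤ γ := by linarith
  have ha : 0 ≤ γ * α := by positivity
  have hB : 0 ≤ entryBound r μ M := entryBound_nonneg hμ
  have hκ1 : 1 ≤ condNumber r M := by
    rw [condNumber, one_le_div hσ]
    exact singularValue_le_sigmaOne _
  -- Since `κ ≤ κ⁵`, the sparse error is small compared with the smallest singular value.
  have hδ : 30000 * (γ * α * (μ * r) * sigmaOne M) ≤ sigmaR r M := by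
    have h1 : condNumber r M ≤ condNumber r M ^ 5 := le_self_pow₀ hκ1 (by norm_num)
    have h2 : γ * α * (μ * r) * condNumber r M ≤ 1 / 30000 :=
      (mul_le_mul_of_nonneg_left h1 (by positivity)).trans hκ
    have h3 : sigmaOne M = condNumber r M * sigmaR r M := by
      rw [condNumber, div_mul_cancel₀ _ hσ.ne']
    rw [h3]
    nlinarith
  have hS₀' : S₀ ∈ sparseSet d₁ d₂ (γ * α) (entryBound r μ M) := by
    have hle : α ≤ γ * α := le_mul_of_one_le_left hα hγ1
    exact ⟨fun i => (hS₀.1 i).trans (by gcongr), fun j => (hS₀.2.1 j).trans (by gcongr), hS₀.2.2⟩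
  have hle : ∀ S ∈ sparseSet d₁ d₂ (γ * α) (entryBound r μ M), ∀ W : Pairs d₁ d₂ r,
      objective r (γ * α) (entryBound r μ M) (M + S₀) W ≤ majorant (M + S₀) S W :=
    fun S hS W => objective_le_majorant ha hB hS W
  have hdir : ∀ S ∈ sparseSet d₁ d₂ (γ * α) (entryBound r μ M), ∀ W : Pairs d₁ d₂ r,
      majorant (M + S₀) S W = objective r (γ * α) (entryBound r μ M) (M + S₀) W → _ :=
    fun S hS W h => exists_direction_of_negative_curvature hr hM hS₀ hγ1 hδ hS W
      (h.trans_le (hle S₀ hS₀' W))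
  constructor
  · intro W hW
    obtain ⟨S, hS, hSW⟩ := exists_majorant_eq_objective ha hB (M + S₀) W
    obtain ⟨Z, hZ, -, a₀, a₁, a₂, a₃, a₄, hline, hcurv⟩ := hdir S hS W hSW
    have hmin : IsLocalMin (majorant (M + S₀) S) W := by
      have hev : ∀ᶠ y in nhds W, objective r (γ * α) (entryBound r μ M) (M + S₀) W ≤
        objective r (γ * α) (entryBound r μ M) (M + S₀) y := hW
      exact hev.mono fun y hy => hSW.trans_le (hy.trans (hle S hS y))
    have hmin' : IsLocalMin
        (fun t : ℝ => a₀ + a₁ * t + a₂ * t ^ 2 + a₃ * t ^ 3 + a₄ * t ^ 4) 0 := by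
      rw [← funext hline]
      have hc : Filter.Tendsto (fun t : ℝ => W + t • (W - Z)) (nhds 0) (nhds W) := by
        have hc' : Continuous fun t : ℝ => W + t • (W - Z) := by fun_prop
        simpa using hc'.tendsto 0
      have hev : ∀ᶠ t : ℝ in nhds 0,
          majorant (M + S₀) S W ≤ majorant (M + S₀) S (W + t • (W - Z)) := hc.eventually hmin
      filter_upwards [hev] with t ht
      simpa using ht
    obtain ⟨h1, h2⟩ := quartic_isLocalMin hmin'
    have h3 : ‖W - Z‖ ^ 2 ≤ 0 := by
      by_contra! h
      nlinarith [mul_pos hσ h]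
    have h4 : W = Z := by
      have : ‖W - Z‖ = 0 := by nlinarith [norm_nonneg (W - Z)]
      exact sub_eq_zero.1 (norm_eq_zero.1 this)
    rw [h4]
    exact hZ
  · intro ε hε _ W
    rcases differentiableAt_objective_or ha hB (M + S₀) W with hd | ⟨S₁, hS₁, S₂, hS₂, h₁, h₂, hne⟩
    · obtain ⟨S, hS, hSW⟩ := exists_majorant_eq_objective ha hB (M + S₀) W
      have hg := contDiff_majorant (r := r) (M + S₀) S
      by_cases hgrad : ε ≤ ‖fderiv ℝ (majorant (M + S₀) S) W‖
      · refine Or.inl ⟨hd, ?_⟩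
        rw [norm_gradient, fderiv_eq_of_touching hd (hg.differentiable (by simp) W) (hle S hS) hSW]
        exact hgrad
      push Not at hgrad
      obtain ⟨Z, hZ, hbal, a₀, a₁, a₂, a₃, a₄, hline, hcurv⟩ := hdir S hS W hSW
      obtain ⟨hd1, hd2⟩ := fderiv_of_quartic_on_line hg hline
      have ha₁ : a₁ ≤ ε * ‖W - Z‖ := by
        rw [← hd1]
        refine (le_abs_self _).trans ?_
        rw [← Real.norm_eq_abs]
        refine ((fderiv ℝ (majorant (M + S₀) S) W).le_opNorm _).trans ?_
        gcongr
      -- The case `W = Z` is separated because the zero vector is no direction of curvature.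
      by_cases hneg : 2 * a₂ ≤ -(1 / 12 * sigmaR r M) * ‖W - Z‖ ^ 2 ∧ W - Z ≠ 0
      · refine Or.inr (Or.inl ⟨_, hg, hle S hS, hSW, ?_⟩)
        exact exists_hasEigenvalue_hessian_le hg hneg.2 (hd2.trans_le hneg.1)
      · refine Or.inr (Or.inr ⟨Z, isLocalMin_objective_of_balanced ha hB hS₀' hZ hbal, ?_⟩)
        have hκ' : 1 ≤ √(condNumber r M) := Real.one_le_sqrt.2 hκ1
        have h5 : ‖W - Z‖ * sigmaR r M ≤ 48 * ε := by
          by_cases h0 : W - Z = 0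
          · rw [h0, norm_zero, zero_mul]; positivity
          · have h6 : -(1 / 12 * sigmaR r M) * ‖W - Z‖ ^ 2 < 2 * a₂ := by
              by_contra! h
              exact hneg ⟨h, h0⟩
            have h7 : 0 < ‖W - Z‖ := norm_pos_iff.2 h0
            have h8 : ‖W - Z‖ * (‖W - Z‖ * sigmaR r M) ≤ ‖W - Z‖ * (48 * ε) := by nlinarith
            exact le_of_mul_le_mul_left h8 h7
        calc ‖W - Z‖ ≤ 48 * ε / sigmaR r M := (le_div_iff₀ hσ).2 h5
          _ ≤ 48 * (ε * √(condNumber r M) / sigmaR r M) := by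
            rw [mul_div_assoc]
            gcongr
            exact le_mul_of_one_le_right hε.le hκ'
    · exact Or.inr (Or.inl (exists_upper_bound_of_kink (contDiff_majorant _ S₁)
        (contDiff_majorant _ S₂) (hle S₁ hS₁) (hle S₂ hS₂) h₁ h₂ hne _))
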